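/- **Setting.** An instance consists of finitely many jobs $j$, each with a release date $r_j\ge 0$ and a processing time $p_j>0$. A feasible (preemptive, single-machine) schedule is described by the amounts $y_j(t)$ of processing that the jobs have received until time $t$: each $y_j$ is non-decreasing, $y_j(t)=0$ for $t\le r_j$, $y_j(t)\le p_j$, all jobs together receive at most $t_2-t_1$ units of processing during $[t_1,t_2]$, and every job is eventually completed. The completion time $C_j$ is the earliest time $t$ with $y_j(t)=p_j$, and the total flow time is $\sum_j (C_j-r_j)$. For $\alpha\in[0,1)$, job $j$ emits a signal at the earliest time $s_j\ge r_j$ with $y_j(s_j)=\alpha p_j$. A (deterministic) algorithm maps every instance to a feasible schedule. It is an *$\alpha$-clairvoyant online algorithm* if its schedule until time $t$ depends only on the jobs released until $t$ and their release dates, the signals emitted until $t$ and their times, and the processing times of the jobs that have emitted their signal until $t$. It is *$c$-competitive* if on every instance its total flow time is at most $c$ times the total flow time of an optimal (equivalently, of every) feasible schedule. **Theorem.** There is an absolute constant $K>0$ such that for every $\alpha\in[0,1)$ there is an $\alpha$-clairvoyant online algorithm that is $\frac{K}{1-\alpha}$-competitive for total flow time on a single machine. Moreover, the algorithm can be taken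 to follow this rule at every time $t$. Let $A(t)=\{j: r_j\le t<C_j\}$, let $C(t)$ be the set of jobs in $A(t)$ that have emitted their signal by time $t$ (that is, $y_j(t)\ge\alpha p_j$), let $N(t)=A(t)\setminus C(t)$, and put $p_j(t)=p_j-y_j(t)$; a minimum over the empty set is $\infty$. 1. If $C(t)\neq\emptyset$ and $\min_{j\in C(t)}p_j(t)\le\frac{1-\alpha}{\alpha}\min_{j\in N(t)}y_j(t)$ (which counts as true if $N(t)=\emptyset$, in particular always if $\alpha=0$), process at rate $1$ only one job of $C(t)$ with smallest $p_j(t)$, chosen among those to have the largest $s_j$. 2. Otherwise, share the machine evenly among the jobs of $N(t)$ with smallest $y_j(t)$, and process no other job. -/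

import Mathlib

namespace FlowTime

/-- An instance: a finite set of jobs (with arbitrary names), each with a release date `r j`
and a processing time `p j`. The values of `r` and `p` outside `jobs` play no role. -/
structure Instance where
  jobs : Finset ℕ
  r : ℕ → ℝ
  p : ℕ → ℝ
  r_nonneg : ∀ j ∈ jobs, 0 ≤ r j
  p_pos : ∀ j ∈ jobs, 0 < p j

/-- A feasible preemptive schedule on one machine of speed `1`, given by the amount `y j t` of
processing that job `j` has received until time `t`. The machine may be shared among
several jobs (rates that add up to at most `1`), and every job is eventually completed. -/
structure Schedule (I : Instance) where
  y : ℕ → ℝ → ℝ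
  mono : ∀ j ∈ I.jobs, Monotone (y j)
  eq_zero : ∀ j ∈ I.jobs, ∀ t ≤ I.r j, y j t = 0
  le_p : ∀ j ∈ I.jobs, ∀ t, y j t ≤ I.p j
  capacity : ∀ s t, s ≤ t → ∑ j ∈ I.jobs, (y j t - y j s) ≤ t - s
  completes : ∀ j ∈ I.jobs, ∃ t, y j t = I.p j

namespace Schedule

variable {I : Instance}

/-- The remaining processing time `p_j(t)`. -/
def rem (S : Schedule I) (j : ℕ) (t : ℝ) : ℝ := I.p j - S.y j t

/-- The completion time `C_j`. -/
noncomputable def completion (S : Schedule I) (j : ℕ) : ℝ :=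
  sInf {t : ℝ | I.r j ≤ t ∧ S.y j t = I.p j}

/-- The total flow time of a schedule. -/
noncomputable def flowTime (S : Schedule I) : ℝ :=
  ∑ j ∈ I.jobs, (S.completion j - I.r j)

/-- Job `j` has been released and has emitted its signal by time `t`, that is, an `α`-fraction
of it has been processed. -/
def Emitted (S : Schedule I) (α : ℝ) (j : ℕ) (t : ℝ) : Prop :=
  j ∈ I.jobs ∧ I.r j ≤ t ∧ α * I.p j ≤ S.y j t

/-- The time `s_j` at which job `j` emits its signal. -/
noncomputable def emission (S : Schedule I) (α : ℝ) (j : ℕ) : ℝ :=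
  sInf {t : ℝ | S.Emitted α j t}

open Classical in
/-- The set `A(t)` of available jobs. -/
noncomputable def available (S : Schedule I) (t : ℝ) : Finset ℕ :=
  {j ∈ I.jobs | I.r j ≤ t ∧ t < S.completion j}

open Classical in
/-- The available jobs that have emitted their signal. -/
noncomputable def clairvoyant (S : Schedule I) (α : ℝ) (t : ℝ) : Finset ℕ :=
  {j ∈ S.available t | S.Emitted α j t}

open Classical in
/-- The available jobs that have not emitted their signal. -/
noncomputable def nonclairvoyant (S : Schedule I) (α : ℝ) (t : ℝ) : Finset ℕ :=
  {j ∈ S.available t | ¬ S.Emitted α j t}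

/-- Job `j` is processed at rate `x` at time `t` (right derivative of its progress). -/
def HasRate (S : Schedule I) (j : ℕ) (x : ℝ) (t : ℝ) : Prop :=
  HasDerivWithinAt (S.y j) x (Set.Ici t) t

/-- The test `min_{j ∈ C} p_j(t) ≤ (1 - α) / α * min_{j ∈ N} y_j(t)`, where `C` and `N` are the
clairvoyant and the non-clairvoyant jobs and a minimum over the empty set is `∞`
(if `C` and `N` are both empty, there is nothing to schedule and the test does not matter). -/
def SRPTTest (S : Schedule I) (α : ℝ) (t : ℝ) : Prop :=
  ∃ k ∈ S.clairvoyant α t, ∀ j ∈ S.nonclairvoyant α t, S.rem k t ≤ (1 - α) / α * S.y j t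

/-- At time `t` only one job `k` is processed (at rate `1`); it is a clairvoyant job of smallest
remaining processing time, and among those one that emitted its signal last. -/
def RunsSRPT (S : Schedule I) (α : ℝ) (t : ℝ) : Prop :=
  ∃ k ∈ S.clairvoyant α t,
    (∀ j ∈ S.clairvoyant α t, S.rem k t ≤ S.rem j t) ∧
    (∀ j ∈ S.clairvoyant α t, S.rem j t = S.rem k t → S.emission α j ≤ S.emission α k) ∧
    ∀ j ∈ I.jobs, S.HasRate j (if j = k then 1 else 0) t

open Classical in
/-- The non-clairvoyant jobs that have received the smallest amount of processing. -/
noncomputable def leastProcessed (S : Schedule I) (α : ℝ) (t : ℝ) : Finset ℕ :=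
  {j ∈ S.nonclairvoyant α t | ∀ i ∈ S.nonclairvoyant α t, S.y j t ≤ S.y i t}

/-- At time `t` the machine is shared evenly among the non-clairvoyant jobs that have received
the smallest amount of processing, and no other job is processed. -/
def RunsSETF (S : Schedule I) (α : ℝ) (t : ℝ) : Prop :=
  ∀ j ∈ I.jobs, S.HasRate j
    (if j ∈ S.leastProcessed α t then 1 / ((S.leastProcessed α t).card : ℝ) else 0) t

/-- The schedule follows, at all times, the SRPT/SETF hybrid rule. -/
def IsHybrid (S : Schedule I) (α : ℝ) : Prop :=
  ∀ t : ℝ, (S.SRPTTest α t → S.RunsSRPT α t) ∧ (¬ S.SRPTTest α t → S.RunsSETF α t)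

end Schedule

/-- A deterministic algorithm assigns to every instance a feasible schedule. -/
abbrev Algorithm := (I : Instance) → Schedule I

/-- Two runs reveal the same information up to time `t`: at every time `τ ≤ t` the same jobs have
been released (so they have the same release dates), the same jobs have emitted their signal
(so the signals come at the same times), and these have the same processing times. -/
def SameInfo (α : ℝ) {I I' : Instance} (S : Schedule I) (S' : Schedule I') (t : ℝ) : Prop :=
  ∀ τ ≤ t, ∀ j,
    ((j ∈ I.jobs ∧ I.r j ≤ τ) ↔ (j ∈ I'.jobs ∧ I'.r j ≤ τ)) ∧
    (S.Emitted α j τ ↔ S'.Emitted α j τ) ∧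
    (S.Emitted α j τ → I.p j = I'.p j)

namespace Algorithm

/-- The algorithm is an `α`-clairvoyant online algorithm: what it has done until time `t` depends
only on the information revealed until time `t` in its own run. -/
def IsClairvoyantOnline (A : Algorithm) (α : ℝ) : Prop :=
  ∀ (I I' : Instance) (t : ℝ), SameInfo α (A I) (A I') t →
    ∀ j ∈ I.jobs, I.r j ≤ t → (A I).y j t = (A I').y j t

/-- The algorithm is `c`-competitive for total flow time: on every instance its total flow time is
at most `c` times that of every feasible offline schedule. -/
def IsCompetitive (A : Algorithm) (c : ℝ) : Prop :=
  ∀ (I : Instance) (S : Schedule I), (A I).flowTime ≤ c * S.flowTime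

end Algorithm

end FlowTime

/-!
The rates prescribed by the hybrid rule depend only on the past, and once they are followed they
stay constant for a while. Hence piecewise linear trajectories that follow the rule are unique and,
being Lipschitz, can be continued forever.

The total flow time is the integral of the number of available jobs, so it suffices to compare these
numbers at each time `t`. Give an available job the priority `min ((1 - α) / α * y_j) (p_j - y_j)`:
the rule always processes jobs of least priority. For a threshold `h`, let `s` be the last time
until `t` at which no available job has priority less than `h`. Since then the machine has been busy
with jobs released from `s` on, each of which has received at most `h / (1 - α)`, and with at most
one older job, which had exactly `h` left at time `s`. Any other schedule has had only `t - s` units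
of time for the new jobs. So the jobs that are available only under the rule and have less than `h`
left have, in total, at most `h` more left than what the rule has spent on those new jobs that are
still available under the other schedule. A counting argument turns these inequalities, for all
`h`, into the bound on the number of jobs.
-/

namespace FlowTime

open Set Filter Topology

/-! ### Functions with one-sided derivatives -/

theorem sub_le_mul_of_right_deriv_le {f f' : ℝ → ℝ} {a b c : ℝ} (hab : a ≤ b)
    (hf : ContinuousOn f (Icc a b))
    (hf' : ∀ t ∈ Ioo a b, HasDerivWithinAt f (f' t) (Ici t) t)
    (hc : ∀ t ∈ Ioo a b, f' t ≤ c) : f b - f a ≤ c * (b - a) := by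
  rcases hab.eq_or_lt with rfl | hlt
  · simp
  have hB (x t : ℝ) : HasDerivAt (fun t => f x + c * (t - x)) c t := by
    simpa using (((hasDerivAt_id t).sub_const x).const_mul c).const_add (f x)
  have hinner : ∀ x ∈ Ioo a b, f b ≤ f x + c * (b - x) := fun x hx =>
    image_le_of_deriv_right_le_deriv_boundary (B := fun t => f x + c * (t - x)) (B' := fun _ => c)
      (hf.mono (Icc_subset_Icc_left hx.1.le)) (fun t ht => hf' t ⟨hx.1.trans_le ht.1, ht.2⟩)
      (by simp) (by fun_prop) (fun t _ => (hB x t).hasDerivWithinAt)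
      (fun t ht => hc t ⟨hx.1.trans_le ht.1, ht.2⟩) ⟨hx.2.le, le_rfl⟩
  have ha : a ∈ closure (Ioo a b) := by
    rw [closure_Ioo hlt.ne]; exact left_mem_Icc.2 hab
  have hcont : ContinuousWithinAt f (Ioo a b) a :=
    (hf a (left_mem_Icc.2 hab)).mono Ioo_subset_Icc_self
  have : f b ≤ f a + c * (b - a) :=
    continuousWithinAt_const.closure_le ha (hcont.add (by fun_prop)) hinner
  linarith

theorem mul_le_sub_of_le_right_deriv {f f' : ℝ → ℝ} {a b c : ℝ} (hab : a ≤ b)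
    (hf : ContinuousOn f (Icc a b))
    (hf' : ∀ t ∈ Ioo a b, HasDerivWithinAt f (f' t) (Ici t) t)
    (hc : ∀ t ∈ Ioo a b, c ≤ f' t) : c * (b - a) ≤ f b - f a := by
  have := sub_le_mul_of_right_deriv_le hab hf.neg (fun t ht => (hf' t ht).neg)
    (fun t ht => neg_le_neg (hc t ht))
  simp only [Pi.neg_apply] at this
  linarith

/-! ### Piecewise linear solutions of causal laws of motion -/

/-- The trajectory `y`, started at `0` at time `0`, moves according to the law `F` until time `b`:
from every time `t < b` on, all coordinates move linearly for a while, with the velocities `F y t`.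
The law may depend on the whole trajectory. -/
structure Follows {ι : Type*} (F : (ι → ℝ → ℝ) → ℝ → ι → ℝ) (y : ι → ℝ → ℝ) (b : ℝ) : Prop where
  continuous : ∀ j, Continuous (y j)
  eq_zero : ∀ j, ∀ t ≤ 0, y j t = 0
  eventually_eq : ∀ t < b, ∀ᶠ s in 𝓝[≥] t, ∀ j, y j s = y j t + F y t j * (s - t)

/-- The velocities prescribed by the law `F` depend only on the past of the trajectory. -/
def IsCausal {ι : Type*} (F : (ι → ℝ → ℝ) → ℝ → ι → ℝ) : Prop :=
  ∀ y z t, (∀ j, ∀ s ≤ t, y j s = z j s) → F y t = F z t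

/-- The trajectory `y` until time `T`, continued linearly with the velocities `ρ`. -/
noncomputable def continuation {ι : Type*} (y : ι → ℝ → ℝ) (T : ℝ) (ρ : ι → ℝ) : ι → ℝ → ℝ :=
  fun j t => y j (min t T) + ρ j * (t - min t T)

/-- The velocities prescribed by the law `F` do not change for a while when they are followed. -/
def IsPersistent {ι : Type*} (F : (ι → ℝ → ℝ) → ℝ → ι → ℝ) : Prop :=
  ∀ y T, ∀ᶠ t in 𝓝[≥] T, F (continuation y T (F y T)) t = F y T

section LawOfMotion

variable {ι : Type*} {F G : (ι → ℝ → ℝ) → ℝ → ι → ℝ} {y z : ι → ℝ → ℝ} {ρ : ι → ℝ}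
  {a b c t s T : ℝ} {j : ι}

theorem continuation_of_le (h : t ≤ T) (j : ι) : continuation y T ρ j t = y j t := by
  simp [continuation, h]

theorem continuation_of_ge (h : T ≤ t) (j : ι) :
    continuation y T ρ j t = y j T + ρ j * (t - T) := by
  simp [continuation, h]

theorem continuous_continuation (hy : Continuous (y j)) : Continuous (continuation y T ρ j) := by
  unfold continuation
  fun_prop

namespace Follows

theorem mono (h : Follows F y b) (hcb : c ≤ b) : Follows F y c :=
  ⟨h.continuous, h.eq_zero, fun t ht => h.eventually_eq t (ht.trans_le hcb)⟩

theorem hasDerivWithinAt (h : Follows F y b) (ht : t < b) (j : ι) :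
    HasDerivWithinAt (y j) (F y t j) (Ici t) t := by
  have hlin : HasDerivAt (fun s => y j t + F y t j * (s - t)) (F y t j) t := by
    simpa using (((hasDerivAt_id t).sub_const t).const_mul (F y t j)).const_add (y j t)
  exact hlin.hasDerivWithinAt.congr_of_eventuallyEq
    ((h.eventually_eq t ht).mono fun s hs => hs j) (by simp)

theorem eq_on (hy : Follows F y b) (hz : Follows G z b) {J : Set ι}
    (hFG : ∀ t < b, (∀ j ∈ J, ∀ s ≤ t, y j s = z j s) → ∀ j ∈ J, F y t j = G z t j)
    (hj : j ∈ J) (ht : t ≤ b) : y j t = z j t := by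
  have hneg : ∀ i, ∀ s ≤ 0, y i s = z i s := fun i s hs => by
    rw [hy.eq_zero i s hs, hz.eq_zero i s hs]
  rcases le_total t 0 with ht0 | ht0
  · exact hneg j t ht0
  have hclosed : IsClosed {s | ∀ i ∈ J, y i s = z i s} := by
    simp only [ofPred_forall]
    exact isClosed_biInter fun i _ => isClosed_eq (hy.continuous i) (hz.continuous i)
  refine (hclosed.inter isClosed_Icc).Icc_subset_of_forall_mem_nhdsGT_of_Icc_subset
    (fun i _ => hneg i 0 le_rfl) (fun s hs hpast => ?_) (⟨ht0, ht⟩ : t ∈ Icc 0 b) j hj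
  have hpast : ∀ i ∈ J, ∀ τ ≤ s, y i τ = z i τ := fun i hi τ hτ =>
    (le_total τ 0).elim (hneg i τ) fun h0 => hpast ⟨h0, hτ⟩ i hi
  filter_upwards [nhdsWithin_mono s Ioi_subset_Ici_self (hy.eventually_eq s hs.2),
    nhdsWithin_mono s Ioi_subset_Ici_self (hz.eventually_eq s hs.2)] with τ hyτ hzτ i hi
  rw [hyτ i, hzτ i, hpast i hi s le_rfl, hFG s hs.2 hpast i hi]

theorem unique (hF : IsCausal F) (hy : Follows F y b) (hz : Follows F z b) (ht : t ≤ b) (j : ι) :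
    y j t = z j t :=
  hy.eq_on hz (J := univ) (fun t _ hpast i _ => by
    rw [hF y z t fun i => hpast i (mem_univ i)]) (mem_univ j) ht

theorem abs_sub_le (h : Follows F y b) (hF : ∀ y t j, |F y t j| ≤ c) (hsb : s ≤ b) (htb : t ≤ b) :
    |y j t - y j s| ≤ c * |t - s| := by
  wlog hst : s ≤ t generalizing s t
  · rw [abs_sub_comm, abs_sub_comm t]
    exact this htb hsb (le_of_not_ge hst)
  have := norm_image_sub_le_of_norm_deriv_right_le_segment (h.continuous j).continuousOn
    (fun τ hτ => h.hasDerivWithinAt (hτ.2.trans_le htb) j) (fun τ _ => hF y τ j) t ⟨hst, le_rfl⟩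
  rwa [Real.norm_eq_abs, ← abs_of_nonneg (sub_nonneg.2 hst)] at this

theorem eventually_eq_of_eqOn (hF : IsCausal F) (hz : Follows F z c) (htc : t < c)
    (h : ∀ j, ∀ s < c, y j s = z j s) :
    ∀ᶠ s in 𝓝[≥] t, ∀ j, y j s = y j t + F y t j * (s - t) := by
  filter_upwards [hz.eventually_eq t htc, nhdsWithin_le_nhds (Iio_mem_nhds htc)] with s hs hsc j
  rw [h j s hsc, h j t htc, hs j, hF y z t fun i τ hτ => h i τ (hτ.trans_lt htc)]

/-- The last time the coordinate passes through the level `v`, it moves. -/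
theorem exists_rate_ne_zero (h : Follows F y b) {v : ℝ} (hac : a ≤ c) (hcb : c ≤ b)
    (ha : y j a ≤ v) (hc : v < y j c) : ∃ τ ∈ Ico a c, y j τ = v ∧ F y τ j ≠ 0 := by
  have hlevel : IsCompact (Icc a c ∩ {τ | y j τ = v}) :=
    isCompact_Icc.inter_right (isClosed_eq (h.continuous j) continuous_const)
  obtain ⟨τ₀, hτ₀, hyτ₀⟩ := intermediate_value_Icc hac (h.continuous j).continuousOn ⟨ha, hc.le⟩
  obtain ⟨τ, ⟨hτ, hyτ⟩, hlast⟩ := hlevel.exists_isGreatest ⟨τ₀, hτ₀, hyτ₀⟩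
  have hτc : τ < c := hτ.2.lt_of_ne fun hτc => hc.ne' (hτc ▸ hyτ)
  refine ⟨τ, ⟨hτ.1, hτc⟩, hyτ, fun hrate => ?_⟩
  have hstay : ∀ᶠ s in 𝓝[>] τ, y j s = v := by
    filter_upwards [nhdsWithin_mono τ Ioi_subset_Ici_self (h.eventually_eq τ (hτc.trans_le hcb))]
      with s hs
    rw [hs j, hrate, zero_mul, add_zero, hyτ]
  obtain ⟨s, hys, hs⟩ := (hstay.and (Ioc_mem_nhdsGT hτc)).exists
  exact hs.1.not_ge (hlast ⟨⟨hτ.1.trans hs.1.le, hs.2⟩, hys⟩)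

theorem exists_extension (hF : IsCausal F) (hF' : IsPersistent F) (h : Follows F y T)
    (hT : 0 ≤ T) : ∃ c > T, ∃ z, Follows F z c := by
  obtain ⟨c, hTc, hpers⟩ := mem_nhdsGE_iff_exists_Ico_subset.1 (hF' y T)
  set z := continuation y T (F y T)
  have hzy : ∀ j, ∀ s ≤ T, z j s = y j s := fun j s hs => continuation_of_le hs j
  have hzT : ∀ j s, T ≤ s → z j s = y j T + F y T j * (s - T) := fun j s hs =>
    continuation_of_ge hs j
  refine ⟨c, hTc, z, fun j => continuous_continuation (h.continuous j),
    fun j t ht => (hzy j t (ht.trans hT)).trans (h.eq_zero j t ht), fun t htc => ?_⟩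
  rcases lt_or_ge t T with htT | hTt
  · exact eventually_eq_of_eqOn hF h htT fun j s hs => hzy j s hs.le
  · have hrate : F z t = F y T := hpers ⟨hTt, htc⟩
    filter_upwards [self_mem_nhdsWithin] with s hs j
    rw [hzT j s (hTt.trans hs), hzT j t hTt, hrate]
    ring

theorem exists_maximal (hF : IsCausal F) (hc : ∀ y t j, |F y t j| ≤ c)
    (h₀ : ∃ b > 0, ∃ z, Follows F z b) :
    ∃ y, ∀ b, (∀ t < b, ∃ b' > t, ∃ z, Follows F z b') → Follows F y b := by
  set U := {t | ∃ b > t, ∃ z, Follows F z b}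
  choose! bound hbound sol hsol using fun t (ht : t ∈ U) => ht
  have hglue : ∀ t ∈ U, ∀ j, ∀ s < bound t, s ∈ U ∧ sol s j s = sol t j s := fun t ht j s hs =>
    have hsU : s ∈ U := ⟨bound t, hs, sol t, hsol t ht⟩
    ⟨hsU, unique hF ((hsol s hsU).mono (hbound s hsU).le) ((hsol t ht).mono hs.le) le_rfl j⟩
  have hlip : ∀ j, LipschitzOnWith c.toNNReal (fun t => sol t j t) U := fun j =>
    LipschitzOnWith.of_dist_le_mul fun t ht s hs => by
      wlog hst : s ≤ t generalizing s t
      · rw [dist_comm, dist_comm t]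
        exact this s hs t ht (le_of_not_ge hst)
      have hst' : s < bound t := hst.trans_lt (hbound t ht)
      rw [(hglue t ht j s hst').2, Real.dist_eq, Real.dist_eq]
      exact (abs_sub_le (hsol t ht) hc hst'.le (hbound t ht).le).trans
        (mul_le_mul_of_nonneg_right (Real.le_coe_toNNReal c) (abs_nonneg _))
  choose y hy_lip hy using fun j => (hlip j).extend_real
  have hysol : ∀ t ∈ U, ∀ j, ∀ s < bound t, y j s = sol t j s := fun t ht j s hs =>
    (hy j (hglue t ht j s hs).1).symm.trans (hglue t ht j s hs).2
  refine ⟨y, fun b hb => ⟨fun j => (hy_lip j).continuous, fun j t ht => ?_, fun t ht => ?_⟩⟩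
  · rw [hysol 0 h₀ j t (ht.trans_lt (hbound 0 h₀)), (hsol 0 h₀).eq_zero j t ht]
  · exact eventually_eq_of_eqOn hF (hsol t (hb t ht)) (hbound t (hb t ht)) (hysol t (hb t ht))

end Follows

theorem exists_follows (hF : IsCausal F) (hF' : IsPersistent F) (hc : ∀ y t j, |F y t j| ≤ c)
    (hneg : ∀ t < 0, F 0 t = 0) : ∃ y, ∀ b, Follows F y b := by
  have hzero : Follows F 0 0 := ⟨fun _ => continuous_const, fun _ _ _ => rfl,
    fun t ht => Eventually.of_forall fun s j => by simp [hneg t ht]⟩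
  have h₀ : ∃ b > 0, ∃ z, Follows F z b := hzero.exists_extension hF hF' le_rfl
  obtain ⟨y, hy⟩ := Follows.exists_maximal hF hc h₀
  suffices hall : ∀ t, ∃ b > t, ∃ z, Follows F z b from ⟨y, fun b => hy b fun t _ => hall t⟩
  by_contra! hcon
  set bad := {t | ¬ ∃ b > t, ∃ z, Follows F z b}
  have hbad_pos : ∀ t ∈ bad, 0 ≤ t := fun t ht => by
    by_contra! hlt
    exact ht ⟨0, hlt, 0, hzero⟩
  have hbad : bad.Nonempty := by
    obtain ⟨t, ht⟩ := hcon
    exact ⟨t, fun ⟨b, hb, z, hz⟩ => ht b hb z hz⟩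
  have hfollows : Follows F y (sInf bad) := hy _ fun t ht =>
    not_not.1 fun htbad => ht.not_ge (csInf_le ⟨0, hbad_pos⟩ htbad)
  obtain ⟨b, hb, z, hz⟩ := hfollows.exists_extension hF hF' (le_csInf hbad hbad_pos)
  obtain ⟨t, htbad, htb⟩ := exists_lt_of_csInf_lt hbad hb
  exact htbad ⟨b, htb, z, hz⟩

end LawOfMotion

/-! ### The rates of the hybrid rule -/

/-- What the hybrid rule looks at: the available jobs that have emitted their signal and those that
have not, the remaining processing times, the processed amounts and the emission times. -/
structure State where
  emitted : Finset ℕ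
  silent : Finset ℕ
  rem : ℕ → ℝ
  y : ℕ → ℝ
  emission : ℕ → ℝ

namespace State

/-- The test that decides between SRPT and SETF, cf. `Schedule.SRPTTest`. -/
def SRPTTest (σ : State) (α : ℝ) : Prop :=
  ∃ k ∈ σ.emitted, ∀ j ∈ σ.silent, σ.rem k ≤ (1 - α) / α * σ.y j

/-- SRPT picks the job with the smallest key: least remaining processing time, then latest
emission. The name of the job breaks the remaining ties. -/
def key (σ : State) (j : ℕ) : ℝ ×ₗ ℝᵒᵈ ×ₗ ℕ :=
  toLex (σ.rem j, toLex (OrderDual.toDual (σ.emission j), j))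

/-- `k` is the job that SRPT picks among the jobs that have emitted their signal. -/
def IsSelected (σ : State) (k : ℕ) : Prop :=
  k ∈ σ.emitted ∧ ∀ j ∈ σ.emitted, σ.key k ≤ σ.key j

open Classical in
/-- The jobs among which SETF shares the machine, cf. `Schedule.leastProcessed`. -/
noncomputable def leastProcessed (σ : State) : Finset ℕ :=
  {j ∈ σ.silent | ∀ i ∈ σ.silent, σ.y j ≤ σ.y i}

open Classical in
/-- The rate at which the hybrid rule processes job `j`. -/
noncomputable def rate (σ : State) (α : ℝ) (j : ℕ) : ℝ :=
  if σ.SRPTTest α then (if σ.IsSelected j then 1 else 0)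
  else if j ∈ σ.leastProcessed then 1 / (σ.leastProcessed.card : ℝ) else 0

/-- The state after the jobs have been processed at the rates `ρ` for `δ` units of time, provided
that no job is released, emits its signal or is completed. -/
def advance (σ : State) (ρ : ℕ → ℝ) (δ : ℝ) : State :=
  { σ with rem := fun j => σ.rem j - ρ j * δ, y := fun j => σ.y j + ρ j * δ }

variable {σ σ' : State} {α : ℝ} {j k : ℕ}

theorem key_le_iff : σ.key k ≤ σ.key j ↔ σ.rem k < σ.rem j ∨ σ.rem k = σ.rem j ∧
    (σ.emission j < σ.emission k ∨ σ.emission k = σ.emission j ∧ k ≤ j) := by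
  simp [key, Prod.Lex.toLex_le_toLex]

theorem mem_leastProcessed :
    j ∈ σ.leastProcessed ↔ j ∈ σ.silent ∧ ∀ i ∈ σ.silent, σ.y j ≤ σ.y i := by
  simp [leastProcessed]

theorem exists_isSelected (h : σ.emitted.Nonempty) : ∃ k, σ.IsSelected k :=
  σ.emitted.exists_min_image σ.key h

theorem leastProcessed_nonempty (h : σ.silent.Nonempty) : σ.leastProcessed.Nonempty := by
  obtain ⟨j, hj, hmin⟩ := σ.silent.exists_min_image σ.y h
  exact ⟨j, mem_leastProcessed.2 ⟨hj, hmin⟩⟩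

theorem SRPTTest.emitted_nonempty (h : σ.SRPTTest α) : σ.emitted.Nonempty :=
  let ⟨k, hk, _⟩ := h; ⟨k, hk⟩

theorem srptTest_of_silent_eq_empty (h : σ.emitted.Nonempty) (h' : σ.silent = ∅) :
    σ.SRPTTest α :=
  let ⟨k, hk⟩ := h; ⟨k, hk, by simp [h']⟩

namespace IsSelected

theorem unique (hk : σ.IsSelected k) (hj : σ.IsSelected j) : k = j := by
  have h := le_antisymm (hk.2 j hj.1) (hj.2 k hk.1)
  simp only [key, EmbeddingLike.apply_eq_iff_eq, Prod.mk.injEq] at h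
  exact h.2.2

theorem rem_le (hk : σ.IsSelected k) (hj : j ∈ σ.emitted) : σ.rem k ≤ σ.rem j := by
  rcases key_le_iff.1 (hk.2 j hj) with h | h
  exacts [h.le, h.1.le]

theorem emission_le (hk : σ.IsSelected k) (hj : j ∈ σ.emitted) (h : σ.rem j = σ.rem k) :
    σ.emission j ≤ σ.emission k := by
  rcases key_le_iff.1 (hk.2 j hj) with h' | ⟨-, h' | h'⟩
  exacts [absurd h h'.ne', h'.le, h'.1.ge]

end IsSelected

theorem rate_of_isSelected (h : σ.SRPTTest α) (hk : σ.IsSelected k) (j : ℕ) :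
    σ.rate α j = if j = k then 1 else 0 := by
  have : σ.IsSelected j ↔ j = k := ⟨fun hj => hj.unique hk, fun hj => hj ▸ hk⟩
  simp only [rate, h, if_true, this]

theorem rate_of_not_srptTest (h : ¬ σ.SRPTTest α) (j : ℕ) :
    σ.rate α j = if j ∈ σ.leastProcessed then 1 / (σ.leastProcessed.card : ℝ) else 0 := by
  simp only [rate, h, if_false]

theorem rate_nonneg (σ : State) (α : ℝ) (j : ℕ) : 0 ≤ σ.rate α j := by
  unfold rate; split_ifs <;> positivity

theorem rate_ne_zero_iff : σ.rate α j ≠ 0 ↔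
    (σ.SRPTTest α ∧ σ.IsSelected j) ∨ (¬ σ.SRPTTest α ∧ j ∈ σ.leastProcessed) := by
  by_cases ht : σ.SRPTTest α
  · simp [rate, ht]
  · simpa [rate, ht] using Finset.ne_empty_of_mem

theorem mem_of_rate_ne_zero (h : σ.rate α j ≠ 0) : j ∈ σ.emitted ∪ σ.silent := by
  rcases rate_ne_zero_iff.1 h with ⟨-, hj⟩ | ⟨-, hj⟩
  · exact Finset.mem_union_left _ hj.1
  · exact Finset.mem_union_right _ (mem_leastProcessed.1 hj).1

theorem sum_rate_eq_one {A : Finset ℕ} (hne : (σ.emitted ∪ σ.silent).Nonempty)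
    (hA : σ.emitted ∪ σ.silent ⊆ A) : ∑ j ∈ A, σ.rate α j = 1 := by
  by_cases ht : σ.SRPTTest α
  · obtain ⟨k, hk⟩ := exists_isSelected ht.emitted_nonempty
    simp only [rate_of_isSelected ht hk, Finset.sum_ite_eq']
    rw [if_pos (hA (Finset.mem_union_left _ hk.1))]
  · have hsilent : σ.silent.Nonempty := by
      by_contra! h
      exact ht (srptTest_of_silent_eq_empty (by simpa [h] using hne) h)
    have hleast : {j ∈ A | j ∈ σ.leastProcessed} = σ.leastProcessed := by
      rw [Finset.filter_mem_eq_inter, Finset.inter_eq_right]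
      exact fun j hj => hA (Finset.mem_union_right _ (mem_leastProcessed.1 hj).1)
    simp only [rate_of_not_srptTest ht]
    rw [← Finset.sum_filter, hleast, Finset.sum_const, nsmul_eq_mul, mul_one_div, div_self]
    exact_mod_cast (leastProcessed_nonempty hsilent).card_pos.ne'

theorem sum_rate_le_one (σ : State) (α : ℝ) (A : Finset ℕ) : ∑ j ∈ A, σ.rate α j ≤ 1 := by
  rcases (σ.emitted ∪ σ.silent).eq_empty_or_nonempty with hempty | hne
  · rw [Finset.sum_eq_zero]
    · exact zero_le_one
    · intro j _
      by_contra h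
      simpa [hempty] using mem_of_rate_ne_zero h
  · calc ∑ j ∈ A, σ.rate α j ≤ ∑ j ∈ A ∪ (σ.emitted ∪ σ.silent), σ.rate α j :=
          Finset.sum_le_sum_of_subset_of_nonneg Finset.subset_union_left
            fun j _ _ => σ.rate_nonneg α j
      _ = 1 := sum_rate_eq_one hne Finset.subset_union_right

theorem rate_le_one (σ : State) (α : ℝ) (j : ℕ) : σ.rate α j ≤ 1 := by
  simpa using σ.sum_rate_le_one α {j}

theorem rate_congr (hemitted : σ.emitted = σ'.emitted) (hsilent : σ.silent = σ'.silent)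
    (hrem : ∀ j ∈ σ.emitted, σ.rem j = σ'.rem j) (hy : ∀ j ∈ σ.silent, σ.y j = σ'.y j)
    (hemission : ∀ j ∈ σ.emitted, σ.emission j = σ'.emission j) : σ.rate α = σ'.rate α := by
  have htest : σ.SRPTTest α ↔ σ'.SRPTTest α := by
    unfold SRPTTest
    rw [← hemitted, ← hsilent]
    refine exists_congr fun k => and_congr_right fun hk => forall₂_congr fun i hi => ?_
    rw [hrem k hk, hy i hi]
  have hleast : σ.leastProcessed = σ'.leastProcessed := by
    ext i
    rw [mem_leastProcessed, mem_leastProcessed, ← hsilent]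
    refine and_congr_right fun hi => forall₂_congr fun l hl => ?_
    rw [hy i hi, hy l hl]
  have hkey : ∀ j ∈ σ.emitted, σ.key j = σ'.key j := fun j hj => by
    rw [key, key, hrem j hj, hemission j hj]
  have hselected : ∀ j, σ.IsSelected j ↔ σ'.IsSelected j := fun j => by
    unfold IsSelected
    rw [← hemitted]
    refine and_congr_right fun hj => forall₂_congr fun l hl => ?_
    rw [hkey j hj, hkey l hl]
  classical
  ext j
  simp only [rate, htest, hleast, hselected]

theorem rate_advance_of_srptTest (hdisj : Disjoint σ.emitted σ.silent) (ht : σ.SRPTTest α)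
    {δ : ℝ} (hδ : 0 ≤ δ) : (σ.advance (σ.rate α) δ).rate α = σ.rate α := by
  obtain ⟨k, hk⟩ := exists_isSelected ht.emitted_nonempty
  rcases hδ.eq_or_lt with rfl | hδ
  · simp [advance]
  have hrate := rate_of_isSelected ht hk
  have hrem_k : (σ.advance (σ.rate α) δ).rem k = σ.rem k - δ := by simp [advance, hrate]
  have hrem : ∀ j ≠ k, (σ.advance (σ.rate α) δ).rem j = σ.rem j := fun j hj => by
    simp [advance, hrate, hj]
  have hy : ∀ j ≠ k, (σ.advance (σ.rate α) δ).y j = σ.y j := fun j hj => by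
    simp [advance, hrate, hj]
  have ht' : (σ.advance (σ.rate α) δ).SRPTTest α := by
    obtain ⟨l, hl, hlN⟩ := ht
    refine ⟨k, hk.1, fun j hj => ?_⟩
    have hjk : j ≠ k := fun h => Finset.disjoint_left.1 hdisj hk.1 (h ▸ hj)
    rw [hrem_k, hy j hjk]
    linarith [hk.rem_le hl, hlN j hj]
  have hk' : (σ.advance (σ.rate α) δ).IsSelected k := by
    refine ⟨hk.1, fun j hj => ?_⟩
    rcases eq_or_ne j k with rfl | hjk
    · exact le_rfl
    · refine key_le_iff.2 (Or.inl ?_)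
      rw [hrem_k, hrem j hjk]
      linarith [hk.rem_le hj]
  ext j
  rw [rate_of_isSelected ht' hk', hrate]

theorem eventually_not_srptTest_advance (ρ : ℕ → ℝ) (ht : ¬ σ.SRPTTest α) :
    ∀ᶠ δ in 𝓝 (0 : ℝ), ¬ (σ.advance ρ δ).SRPTTest α := by
  have hfail : ∀ k ∈ σ.emitted, ∃ j ∈ σ.silent, (1 - α) / α * σ.y j < σ.rem k := fun k hk => by
    by_contra! hcon
    exact ht ⟨k, hk, hcon⟩
  have : ∀ᶠ δ in 𝓝 (0 : ℝ), ∀ k ∈ σ.emitted, ∃ j ∈ σ.silent,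
      (1 - α) / α * (σ.y j + ρ j * δ) < σ.rem k - ρ k * δ := by
    rw [eventually_all_finset]
    intro k hk
    obtain ⟨j, hj, hlt⟩ := hfail k hk
    have : ∀ᶠ δ in 𝓝 (0 : ℝ), (1 - α) / α * (σ.y j + ρ j * δ) < σ.rem k - ρ k * δ :=
      ContinuousAt.eventually_lt (by fun_prop) (by fun_prop) (by simpa using hlt)
    exact this.mono fun δ h => ⟨j, hj, h⟩
  refine this.mono fun δ h => ?_
  rintro ⟨k, hk, hkN⟩
  obtain ⟨j, hj, hlt⟩ := h k hk
  exact (hkN j hj).not_gt hlt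

theorem eventually_leastProcessed_advance {ρ : ℕ → ℝ}
    (hρ : ∀ i ∈ σ.leastProcessed, ∀ j ∈ σ.leastProcessed, ρ i = ρ j) :
    ∀ᶠ δ in 𝓝 (0 : ℝ), (σ.advance ρ δ).leastProcessed = σ.leastProcessed := by
  have : ∀ᶠ δ in 𝓝 (0 : ℝ), ∀ i ∈ σ.silent, ∀ j ∈ σ.silent, σ.y i < σ.y j →
      σ.y i + ρ i * δ < σ.y j + ρ j * δ := by
    simp only [eventually_all_finset, eventually_imp_distrib_left]
    exact fun i _ j _ hij =>
      ContinuousAt.eventually_lt (by fun_prop) (by fun_prop) (by simpa using hij)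
  refine this.mono fun δ h => ?_
  ext j
  simp only [mem_leastProcessed, advance]
  refine and_congr_right fun hj => ⟨fun hmin i hi => ?_, fun hmin i hi => ?_⟩
  · by_contra! hlt
    exact (hmin i hi).not_gt (h i hi j hj hlt)
  · rcases (hmin i hi).eq_or_lt with heq | hlt
    · rw [heq, hρ j (mem_leastProcessed.2 ⟨hj, hmin⟩) i
        (mem_leastProcessed.2 ⟨hi, heq ▸ hmin⟩)]
    · exact (h j hj i hi hlt).le

theorem eventually_rate_advance (σ : State) (α : ℝ) (hdisj : Disjoint σ.emitted σ.silent) :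
    ∀ᶠ δ in 𝓝[≥] (0 : ℝ), (σ.advance (σ.rate α) δ).rate α = σ.rate α := by
  by_cases ht : σ.SRPTTest α
  · exact eventually_mem_nhdsWithin.mono fun δ hδ => rate_advance_of_srptTest hdisj ht hδ
  · have hshare : ∀ i ∈ σ.leastProcessed, ∀ j ∈ σ.leastProcessed, σ.rate α i = σ.rate α j :=
      fun i hi j hj => by simp [rate_of_not_srptTest ht, hi, hj]
    filter_upwards [nhdsWithin_le_nhds (eventually_not_srptTest_advance (σ.rate α) ht),
      nhdsWithin_le_nhds (eventually_leastProcessed_advance hshare)] with δ htest hleast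
    ext j
    rw [rate_of_not_srptTest htest, hleast, rate_of_not_srptTest ht]

end State

/-! ### The hybrid rule as a law of motion -/

/-- Job `j` is released and unfinished at time `t` along the trajectory `y`. -/
def IsAvailable (I : Instance) (y : ℕ → ℝ → ℝ) (j : ℕ) (t : ℝ) : Prop :=
  j ∈ I.jobs ∧ I.r j ≤ t ∧ y j t < I.p j

/-- Job `j` has emitted its signal by time `t` along the trajectory `y`, cf. `Schedule.Emitted`. -/
def HasEmitted (I : Instance) (α : ℝ) (y : ℕ → ℝ → ℝ) (j : ℕ) (t : ℝ) : Prop :=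
  j ∈ I.jobs ∧ I.r j ≤ t ∧ α * I.p j ≤ y j t

open Classical in
/-- The state at time `t` of the trajectory `y`. -/
noncomputable def observe (I : Instance) (α : ℝ) (y : ℕ → ℝ → ℝ) (t : ℝ) : State where
  emitted := {j ∈ I.jobs | IsAvailable I y j t ∧ HasEmitted I α y j t}
  silent := {j ∈ I.jobs | IsAvailable I y j t ∧ ¬ HasEmitted I α y j t}
  rem j := I.p j - y j t
  y j := y j t
  emission j := sInf {τ | HasEmitted I α y j τ}

/-- The law of motion of the hybrid rule. -/
noncomputable def hybridRate (I : Instance) (α : ℝ) (y : ℕ → ℝ → ℝ) (t : ℝ) : ℕ → ℝ :=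
  (observe I α y t).rate α

section HybridRate

variable {I I' : Instance} {α t T : ℝ} {y z : ℕ → ℝ → ℝ} {ρ : ℕ → ℝ} {j : ℕ}

theorem mem_emitted_observe :
    j ∈ (observe I α y t).emitted ↔ IsAvailable I y j t ∧ HasEmitted I α y j t := by
  simp only [observe, Finset.mem_filter, and_iff_right_iff_imp]
  exact fun h => h.1.1

theorem mem_silent_observe :
    j ∈ (observe I α y t).silent ↔ IsAvailable I y j t ∧ ¬ HasEmitted I α y j t := by
  simp only [observe, Finset.mem_filter, and_iff_right_iff_imp]
  exact fun h => h.1.1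

theorem mem_emitted_union_silent_observe :
    j ∈ (observe I α y t).emitted ∪ (observe I α y t).silent ↔ IsAvailable I y j t := by
  rw [Finset.mem_union, mem_emitted_observe, mem_silent_observe, ← and_or_left]
  exact and_iff_left (em _)

theorem disjoint_emitted_silent_observe (I : Instance) (α : ℝ) (y : ℕ → ℝ → ℝ) (t : ℝ) :
    Disjoint (observe I α y t).emitted (observe I α y t).silent :=
  Finset.disjoint_left.2 fun _ h h' => (mem_silent_observe.1 h').2 (mem_emitted_observe.1 h).2

theorem IsAvailable.of_hybridRate_ne_zero (h : hybridRate I α y t j ≠ 0) : IsAvailable I y j t :=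
  mem_emitted_union_silent_observe.1 (State.mem_of_rate_ne_zero h)

theorem hybridRate_nonneg (I : Instance) (α : ℝ) (y : ℕ → ℝ → ℝ) (t : ℝ) (j : ℕ) :
    0 ≤ hybridRate I α y t j :=
  State.rate_nonneg ..

theorem abs_hybridRate_le_one (I : Instance) (α : ℝ) (y : ℕ → ℝ → ℝ) (t : ℝ) (j : ℕ) :
    |hybridRate I α y t j| ≤ 1 := by
  rw [abs_of_nonneg (hybridRate_nonneg ..)]
  exact State.rate_le_one ..

theorem IsAvailable.sum_hybridRate_eq_one (h : IsAvailable I y j t) :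
    ∑ i ∈ I.jobs, hybridRate I α y t i = 1 :=
  State.sum_rate_eq_one ⟨j, mem_emitted_union_silent_observe.2 h⟩
    fun _ hi => (mem_emitted_union_silent_observe.1 hi).1

theorem emission_congr {t' : ℝ} (h : HasEmitted I α y j t')
    (hpast : ∀ τ ≤ t', HasEmitted I α y j τ ↔ HasEmitted I' α z j τ) :
    sInf {τ | HasEmitted I α y j τ} = sInf {τ | HasEmitted I' α z j τ} := by
  have hle : ∀ {A B : Set ℝ}, BddBelow A → t' ∈ A → t' ∈ B → (∀ τ ≤ t', τ ∈ B → τ ∈ A) →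
      sInf A ≤ sInf B := fun hA htA htB hBA => le_csInf ⟨t', htB⟩ fun τ hτ =>
    (le_total τ t').elim (fun h => csInf_le hA (hBA τ h hτ)) (csInf_le hA htA).trans
  have h' : HasEmitted I' α z j t' := (hpast t' le_rfl).1 h
  exact le_antisymm (hle ⟨I.r j, fun _ hτ => hτ.2.1⟩ h h' fun τ hτ => (hpast τ hτ).2)
    (hle ⟨I'.r j, fun _ hτ => hτ.2.1⟩ h' h fun τ hτ => (hpast τ hτ).1)

theorem hybridRate_congr (havailable : ∀ i, IsAvailable I y i t ↔ IsAvailable I' z i t)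
    (hemitted : ∀ i, ∀ τ ≤ t, HasEmitted I α y i τ ↔ HasEmitted I' α z i τ)
    (hp : ∀ i, HasEmitted I α y i t → I.p i = I'.p i)
    (hy : ∀ i, IsAvailable I y i t → y i t = z i t) :
    hybridRate I α y t = hybridRate I' α z t := by
  refine State.rate_congr ?_ ?_ (fun i hi => ?_) (fun i hi => ?_) (fun i hi => ?_)
  · ext i
    rw [mem_emitted_observe, mem_emitted_observe, havailable, hemitted i t le_rfl]
  · ext i
    rw [mem_silent_observe, mem_silent_observe, havailable, hemitted i t le_rfl]
  · obtain ⟨hav, hem⟩ := mem_emitted_observe.1 hi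
    simp only [observe, hp i hem, hy i hav]
  · exact hy i (mem_silent_observe.1 hi).1
  · exact emission_congr (mem_emitted_observe.1 hi).2 (hemitted i)

theorem isCausal_hybridRate (I : Instance) (α : ℝ) : IsCausal (hybridRate I α) :=
  fun y z t h => hybridRate_congr (fun i => by simp only [IsAvailable, h i t le_rfl])
    (fun i τ hτ => by simp only [HasEmitted, h i τ hτ]) (fun _ _ => rfl)
    (fun i _ => h i t le_rfl)

theorem hybridRate_of_neg (I : Instance) (α : ℝ) (y : ℕ → ℝ → ℝ) (ht : t < 0) :
    hybridRate I α y t = 0 := by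
  ext j
  by_contra h
  obtain ⟨hj, hr, -⟩ := IsAvailable.of_hybridRate_ne_zero h
  exact ((I.r_nonneg j hj).trans hr).not_gt ht

theorem eventually_nhdsGE_le_iff {X : Type*} [LinearOrder X] [TopologicalSpace X] [OrderTopology X]
    (r T : X) : ∀ᶠ t in 𝓝[≥] T, (r ≤ t ↔ r ≤ T) := by
  rcases le_or_gt r T with hr | hr
  · filter_upwards [self_mem_nhdsWithin] with t ht using iff_of_true (hr.trans ht) hr
  · filter_upwards [nhdsWithin_le_nhds (Iio_mem_nhds hr)] with t ht
      using iff_of_false (not_le.2 ht) (not_le.2 hr)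

theorem eventually_continuation_lt {c : ℝ} (ρ : ℕ → ℝ) (h : y j T < c) :
    ∀ᶠ t in 𝓝[≥] T, continuation y T ρ j t < c := by
  have hlin : ∀ᶠ t in 𝓝 T, y j T + ρ j * (t - T) < c :=
    ContinuousAt.eventually_lt (by fun_prop) continuousAt_const (by simpa using h)
  filter_upwards [nhdsWithin_le_nhds hlin, self_mem_nhdsWithin] with t ht hTt
  rwa [continuation_of_ge hTt]

theorem eventually_isAvailable_continuation_iff (hρ : ρ j ≠ 0 → IsAvailable I y j T) :
    ∀ᶠ t in 𝓝[≥] T, (IsAvailable I (continuation y T ρ) j t ↔ IsAvailable I y j T) := by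
  rcases lt_or_ge (y j T) (I.p j) with hlt | hge
  · filter_upwards [eventually_nhdsGE_le_iff (I.r j) T, eventually_continuation_lt ρ hlt]
      with t hr hz
    simp only [IsAvailable, hr, hz, hlt]
  · have hrest : ρ j = 0 := by
      by_contra h
      exact (hρ h).2.2.not_ge hge
    filter_upwards [self_mem_nhdsWithin] with t ht
    simp [IsAvailable, continuation_of_ge ht, hrest, hge.not_gt]

theorem eventually_hasEmitted_continuation_iff (hρ : 0 ≤ ρ j) :
    ∀ᶠ t in 𝓝[≥] T, (HasEmitted I α (continuation y T ρ) j t ↔ HasEmitted I α y j T) := by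
  rcases lt_or_ge (y j T) (α * I.p j) with hlt | hge
  · filter_upwards [eventually_continuation_lt ρ hlt] with t hz
    simp [HasEmitted, hz.not_ge, hlt.not_ge]
  · filter_upwards [eventually_nhdsGE_le_iff (I.r j) T, self_mem_nhdsWithin] with t hr ht
    have hz : α * I.p j ≤ continuation y T ρ j t := by
      rw [continuation_of_ge ht]
      exact hge.trans (le_add_of_nonneg_right (mul_nonneg hρ (sub_nonneg.2 ht)))
    simp only [HasEmitted, hr, hz, hge]

theorem hybridRate_continuation (ht : T ≤ t)
    (havailable : ∀ i ∈ I.jobs,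
      (IsAvailable I (continuation y T ρ) i t ↔ IsAvailable I y i T))
    (hemitted : ∀ i ∈ I.jobs,
      (HasEmitted I α (continuation y T ρ) i t ↔ HasEmitted I α y i T)) :
    hybridRate I α (continuation y T ρ) t = ((observe I α y T).advance ρ (t - T)).rate α := by
  have hy : ∀ i, continuation y T ρ i t = y i T + ρ i * (t - T) := continuation_of_ge ht
  have hsets : (observe I α (continuation y T ρ) t).emitted = (observe I α y T).emitted ∧
      (observe I α (continuation y T ρ) t).silent = (observe I α y T).silent := by
    classical
    constructor <;> refine Finset.filter_congr fun i hi => ?_ <;>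
      rw [havailable i hi, hemitted i hi]
  refine State.rate_congr hsets.1 hsets.2 (fun i _ => ?_) (fun i _ => hy i) (fun i hi => ?_)
  · simp only [observe, State.advance, hy]
    ring
  · rw [hsets.1] at hi
    refine (emission_congr (mem_emitted_observe.1 hi).2 fun τ hτ => ?_).symm
    rw [HasEmitted, HasEmitted, continuation_of_le hτ]

theorem isPersistent_hybridRate (I : Instance) (α : ℝ) : IsPersistent (hybridRate I α) := by
  intro y T
  have hshift : Tendsto (fun t => t - T) (𝓝[≥] T) (𝓝[≥] 0) := by
    refine tendsto_nhdsWithin_iff.2 ⟨?_, ?_⟩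
    · exact ((continuous_sub_right T).tendsto' T 0 (sub_self T)).mono_left nhdsWithin_le_nhds
    · exact eventually_mem_nhdsWithin.mono fun t ht => mem_Ici.2 (sub_nonneg.2 ht)
  filter_upwards [self_mem_nhdsWithin,
    (eventually_all_finset I.jobs).2 fun i _ => eventually_isAvailable_continuation_iff
      (I := I) (ρ := hybridRate I α y T) (j := i) IsAvailable.of_hybridRate_ne_zero,
    (eventually_all_finset I.jobs).2 fun i _ => eventually_hasEmitted_continuation_iff
      (I := I) (α := α) (y := y) (T := T) (hybridRate_nonneg I α y T i),
    hshift.eventually ((observe I α y T).eventually_rate_advance α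
      (disjoint_emitted_silent_observe I α y T))] with t ht havailable hemitted hrate
  rw [hybridRate_continuation ht havailable hemitted]
  exact hrate

end HybridRate

/-! ### Trajectories of the hybrid rule -/

/-- The trajectory `y` follows the hybrid rule forever. -/
def FollowsHybrid (I : Instance) (α : ℝ) (y : ℕ → ℝ → ℝ) : Prop :=
  ∀ b, Follows (hybridRate I α) y b

theorem exists_followsHybrid (I : Instance) (α : ℝ) : ∃ y, FollowsHybrid I α y :=
  exists_follows (isCausal_hybridRate I α) (isPersistent_hybridRate I α)
    (abs_hybridRate_le_one I α) fun _ ht => hybridRate_of_neg I α 0 ht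

namespace FollowsHybrid

variable {I : Instance} {α a b s t v : ℝ} {y : ℕ → ℝ → ℝ} {j : ℕ}

theorem continuous (h : FollowsHybrid I α y) (j : ℕ) : Continuous (y j) :=
  (h 0).continuous j

theorem hasDerivWithinAt (h : FollowsHybrid I α y) (j : ℕ) (t : ℝ) :
    HasDerivWithinAt (y j) (hybridRate I α y t j) (Ici t) t :=
  (h (t + 1)).hasDerivWithinAt (lt_add_one t) j

theorem hasDerivWithinAt_sum (h : FollowsHybrid I α y) (t : ℝ) :
    HasDerivWithinAt (fun s => ∑ j ∈ I.jobs, y j s) (∑ j ∈ I.jobs, hybridRate I α y t j)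
      (Ici t) t :=
  HasDerivWithinAt.fun_sum fun j _ => h.hasDerivWithinAt j t

theorem continuous_sum (h : FollowsHybrid I α y) : Continuous fun s => ∑ j ∈ I.jobs, y j s :=
  continuous_finsetSum _ fun j _ => h.continuous j

theorem monotone (h : FollowsHybrid I α y) (j : ℕ) : Monotone (y j) := fun s t hst => by
  have := mul_le_sub_of_le_right_deriv (c := 0) hst (h.continuous j).continuousOn
    (fun τ _ => h.hasDerivWithinAt j τ) (fun τ _ => hybridRate_nonneg I α y τ j)
  linarith

theorem nonneg (h : FollowsHybrid I α y) (j : ℕ) (t : ℝ) : 0 ≤ y j t := by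
  rw [← (h 0).eq_zero j (min t 0) (min_le_right t 0)]
  exact h.monotone j (min_le_left t 0)

theorem exists_hybridRate_ne_zero (h : FollowsHybrid I α y) (ha : y j a ≤ v) (hb : v < y j b) :
    ∃ τ ∈ Ico a b, y j τ = v ∧ hybridRate I α y τ j ≠ 0 :=
  (h b).exists_rate_ne_zero ((h.monotone j).reflect_lt (ha.trans_lt hb)).le le_rfl ha hb

theorem eq_zero_of_le_release (h : FollowsHybrid I α y) (ht : t ≤ I.r j) : y j t = 0 := by
  by_contra hne
  have hpos : 0 < y j t := (h.nonneg j t).lt_of_ne' hne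
  obtain ⟨τ, hτ, -, hrate⟩ :=
    h.exists_hybridRate_ne_zero ((h 0).eq_zero j 0 le_rfl).le hpos
  exact (IsAvailable.of_hybridRate_ne_zero hrate).2.1.not_gt (hτ.2.trans_le ht)

theorem le_p (h : FollowsHybrid I α y) (hj : j ∈ I.jobs) (t : ℝ) : y j t ≤ I.p j := by
  by_contra! hlt
  have h₀ : y j 0 ≤ I.p j := ((h 0).eq_zero j 0 le_rfl).trans_le (I.p_pos j hj).le
  obtain ⟨τ, -, hτ, hrate⟩ := h.exists_hybridRate_ne_zero h₀ hlt
  exact (IsAvailable.of_hybridRate_ne_zero hrate).2.2.ne hτ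

theorem sum_sub_le (h : FollowsHybrid I α y) (hst : s ≤ t) :
    ∑ j ∈ I.jobs, (y j t - y j s) ≤ t - s := by
  have := sub_le_mul_of_right_deriv_le (c := 1) hst h.continuous_sum.continuousOn
    (fun τ _ => h.hasDerivWithinAt_sum τ) (fun τ _ => State.sum_rate_le_one ..)
  rw [Finset.sum_sub_distrib]
  linarith

theorem le_sum_sub (h : FollowsHybrid I α y) (hst : s ≤ t)
    (hbusy : ∀ τ ∈ Ioo s t, ∃ j, IsAvailable I y j τ) :
    t - s ≤ ∑ j ∈ I.jobs, (y j t - y j s) := by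
  have := mul_le_sub_of_le_right_deriv (c := 1) hst h.continuous_sum.continuousOn
    (fun τ _ => h.hasDerivWithinAt_sum τ)
    (fun τ hτ => let ⟨_, hj⟩ := hbusy τ hτ; hj.sum_hybridRate_eq_one.ge)
  rw [Finset.sum_sub_distrib]
  linarith

theorem eq_p_of_sum_lt (h : FollowsHybrid I α y)
    (ht : ∑ j ∈ I.jobs, I.r j + ∑ j ∈ I.jobs, I.p j < t) (hj : j ∈ I.jobs) : y j t = I.p j := by
  set R := ∑ j ∈ I.jobs, I.r j
  refine (h.le_p hj t).antisymm ?_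
  by_contra! hlt
  have hRt : R ≤ t := by
    linarith [Finset.sum_nonneg fun j hj => (I.p_pos j hj).le]
  have hbusy : t - R ≤ ∑ j ∈ I.jobs, (y j t - y j R) := h.le_sum_sub hRt fun τ hτ =>
    ⟨j, hj, (Finset.single_le_sum I.r_nonneg hj).trans hτ.1.le,
      (h.monotone j hτ.2.le).trans_lt hlt⟩
  have hwork : ∑ j ∈ I.jobs, (y j t - y j R) ≤ ∑ j ∈ I.jobs, I.p j :=
    Finset.sum_le_sum fun i hi => by linarith [h.le_p hi t, h.nonneg i R]
  linarith

end FollowsHybrid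

/-- The hybrid algorithm. -/
noncomputable def hybrid (α : ℝ) : Algorithm := fun I =>
  have h := (exists_followsHybrid I α).choose_spec
  { y := (exists_followsHybrid I α).choose
    mono := fun j _ => h.monotone j
    eq_zero := fun _ _ _ ht => h.eq_zero_of_le_release ht
    le_p := fun _ hj => h.le_p hj
    capacity := fun _ _ hst => h.sum_sub_le hst
    completes := fun _ hj => ⟨_, h.eq_p_of_sum_lt (lt_add_one _) hj⟩ }

theorem followsHybrid_hybrid (α : ℝ) (I : Instance) : FollowsHybrid I α (hybrid α I).y :=
  (exists_followsHybrid I α).choose_spec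

/-! ### Schedules -/

namespace Schedule

variable {I : Instance} {t : ℝ} {j : ℕ}

theorem continuous_y (S : Schedule I) (hj : j ∈ I.jobs) : Continuous (S.y j) := by
  have hsub : ∀ {s t}, s ≤ t → S.y j t - S.y j s ≤ t - s := fun {s t} hst =>
    (Finset.single_le_sum (f := fun j => S.y j t - S.y j s)
      (fun i hi => sub_nonneg.2 (S.mono i hi hst)) hj).trans (S.capacity s t hst)
  refine (LipschitzWith.of_le_add (f := S.y j) fun s t => ?_).continuous
  rcases le_total s t with hst | hst
  · exact (S.mono j hj hst).trans (le_add_of_nonneg_right dist_nonneg)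
  · rw [Real.dist_eq, abs_of_nonneg (sub_nonneg.2 hst)]
    linarith [hsub hst]

theorem nonneg (S : Schedule I) (hj : j ∈ I.jobs) (t : ℝ) : 0 ≤ S.y j t := by
  rw [← S.eq_zero j hj (min t (I.r j)) (min_le_right _ _)]
  exact S.mono j hj (min_le_left _ _)

theorem completion_mem (S : Schedule I) (hj : j ∈ I.jobs) :
    S.completion j ∈ {t : ℝ | I.r j ≤ t ∧ S.y j t = I.p j} := by
  refine IsClosed.csInf_mem ?_ ?_ ⟨I.r j, fun t ht => ht.1⟩
  · exact isClosed_Ici.inter (isClosed_eq (S.continuous_y hj) continuous_const)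
  · obtain ⟨t, ht⟩ := S.completes j hj
    refine ⟨t, ?_, ht⟩
    by_contra! hlt
    linarith [S.eq_zero j hj t hlt.le, I.p_pos j hj]

theorem lt_completion_iff (S : Schedule I) (hj : j ∈ I.jobs) (hr : I.r j ≤ t) :
    t < S.completion j ↔ S.y j t < I.p j := by
  refine ⟨fun h => (S.le_p j hj t).lt_of_ne fun heq => ?_, fun h => ?_⟩
  · exact h.not_ge (csInf_le ⟨I.r j, fun t ht => ht.1⟩ ⟨hr, heq⟩)
  · by_contra! hle
    exact h.not_ge ((S.completion_mem hj).2.symm.trans_le (S.mono j hj hle))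

theorem mem_available (S : Schedule I) : j ∈ S.available t ↔ IsAvailable I S.y j t := by
  classical
  rw [available, Finset.mem_filter]
  exact and_congr_right fun hj => and_congr_right fun hr => S.lt_completion_iff hj hr

theorem clairvoyant_eq (S : Schedule I) (α t : ℝ) :
    S.clairvoyant α t = (observe I α S.y t).emitted := by
  classical
  ext j
  rw [clairvoyant, Finset.mem_filter, mem_available, mem_emitted_observe]
  rfl

theorem nonclairvoyant_eq (S : Schedule I) (α t : ℝ) :
    S.nonclairvoyant α t = (observe I α S.y t).silent := by
  classical
  ext j
  rw [nonclairvoyant, Finset.mem_filter, mem_available, mem_silent_observe]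
  rfl

theorem leastProcessed_eq (S : Schedule I) (α t : ℝ) :
    S.leastProcessed α t = (observe I α S.y t).leastProcessed := by
  rw [leastProcessed, nonclairvoyant_eq]
  rfl

theorem srptTest_iff (S : Schedule I) (α t : ℝ) :
    S.SRPTTest α t ↔ (observe I α S.y t).SRPTTest α := by
  rw [SRPTTest, clairvoyant_eq, nonclairvoyant_eq]
  rfl

end Schedule

theorem FollowsHybrid.isHybrid {I : Instance} {S : Schedule I} {α : ℝ}
    (h : FollowsHybrid I α S.y) : S.IsHybrid α := by
  intro t
  rw [S.srptTest_iff]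
  refine ⟨fun ht => ?_, fun ht j _ => ?_⟩
  · obtain ⟨k, hk⟩ := State.exists_isSelected ht.emitted_nonempty
    rw [Schedule.RunsSRPT, S.clairvoyant_eq]
    refine ⟨k, hk.1, fun j => hk.rem_le, fun j => hk.emission_le, fun j _ => ?_⟩
    rw [← State.rate_of_isSelected ht hk]
    exact h.hasDerivWithinAt j t
  · rw [S.leastProcessed_eq, ← State.rate_of_not_srptTest ht]
    exact h.hasDerivWithinAt j t

theorem isAvailable_iff_of_sameInfo {I I' : Instance} {α t τ : ℝ} {S : Schedule I}
    {S' : Schedule I'} (hα : α < 1) (hinfo : SameInfo α S S' t) (hτ : τ ≤ t)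
    (hy : ∀ j ∈ I.jobs, I.r j ≤ τ → S.y j τ = S'.y j τ) (j : ℕ) :
    IsAvailable I S.y j τ ↔ IsAvailable I' S'.y j τ := by
  obtain ⟨hrel, hem, hp⟩ := hinfo τ hτ j
  have hsplit : ∀ {J : Instance} {R : Schedule J}, IsAvailable J R.y j τ ↔
      (j ∈ J.jobs ∧ J.r j ≤ τ) ∧ (R.Emitted α j τ → R.y j τ < J.p j) := fun {J R} => by
    refine ⟨fun h => ⟨⟨h.1, h.2.1⟩, fun _ => h.2.2⟩, fun ⟨⟨hj, hr⟩, h⟩ => ⟨hj, hr, ?_⟩⟩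
    by_contra! hge
    exact (h ⟨hj, hr, by nlinarith [J.p_pos j hj]⟩).not_ge hge
  rw [hsplit, hsplit, ← hrel, ← hem]
  refine and_congr_right fun ⟨hj, hr⟩ => forall_congr' fun h => ?_
  rw [hy j hj hr, hp h]

theorem hybrid_isClairvoyantOnline {α : ℝ} (hα : α < 1) : (hybrid α).IsClairvoyantOnline α := by
  intro I I' t hinfo j hj hr
  refine (followsHybrid_hybrid α I t).eq_on (followsHybrid_hybrid α I' t)
    (J := {i | i ∈ I.jobs ∧ I.r i ≤ t}) (fun τ hτ hpast i _ => ?_) ⟨hj, hr⟩ le_rfl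
  have hy : ∀ i ∈ I.jobs, I.r i ≤ τ → (hybrid α I).y i τ = (hybrid α I').y i τ :=
    fun i hi hri => hpast i ⟨hi, hri.trans hτ.le⟩ τ le_rfl
  rw [hybridRate_congr (isAvailable_iff_of_sameInfo hα hinfo hτ.le hy)
    (fun l τ' hτ' => (hinfo τ' (hτ'.trans hτ.le) l).2.1) (fun l => (hinfo τ hτ.le l).2.2)
    (fun l hl => hy l hl.1 hl.2.1)]

/-! ### Priorities -/

/-- The remaining processing time of a job of length `p` that has been processed for `x` units if
it has emitted its signal, and otherwise what would remain if it emitted its signal now. The case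
distinction is needed because `(1 - 0) / 0 = 0`. -/
noncomputable def priority (α p x : ℝ) : ℝ :=
  if α = 0 then p - x else min ((1 - α) / α * x) (p - x)

section Priority

variable {I : Instance} {α p t x : ℝ} {y : ℕ → ℝ → ℝ} {i j : ℕ}

theorem continuous_priority (α p : ℝ) : Continuous (priority α p) := by
  unfold priority
  split_ifs <;> fun_prop

theorem priority_le_sub (α p x : ℝ) : priority α p x ≤ p - x := by
  unfold priority
  split_ifs
  exacts [le_rfl, min_le_right _ _]

theorem priority_of_ge (hα : 0 ≤ α) (h : α * p ≤ x) : priority α p x = p - x := by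
  unfold priority
  split_ifs with hα₀
  · rfl
  · refine min_eq_right ?_
    rw [div_mul_eq_mul_div, le_div_iff₀ (hα.lt_of_ne' hα₀)]
    linarith

theorem priority_of_le (hα : 0 < α) (h : x ≤ α * p) : priority α p x = (1 - α) / α * x := by
  rw [priority, if_neg hα.ne']
  refine min_eq_left ?_
  rw [div_mul_eq_mul_div, div_le_iff₀ hα]
  linarith

theorem mul_le_priority_mul (hα : 0 ≤ α) (h : x ≤ p) : (1 - α) * x ≤ priority α p (α * x) := by
  rcases hα.eq_or_lt with rfl | hα
  · simpa [priority] using h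
  · rw [priority_of_le hα (mul_le_mul_of_nonneg_left h hα.le), ← mul_assoc,
      div_mul_cancel₀ _ hα.ne']

theorem priority_of_mem_emitted (hα : 0 ≤ α) (hj : j ∈ (observe I α y t).emitted) :
    priority α (I.p j) (y j t) = (observe I α y t).rem j :=
  priority_of_ge hα (mem_emitted_observe.1 hj).2.2.2

namespace FollowsHybrid

theorem priority_of_mem_silent (hy : FollowsHybrid I α y) (hα : 0 ≤ α)
    (hj : j ∈ (observe I α y t).silent) :
    priority α (I.p j) (y j t) = (1 - α) / α * (observe I α y t).y j := by
  obtain ⟨⟨hjobs, hr, -⟩, hsilent⟩ := mem_silent_observe.1 hj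
  have hlt : y j t < α * I.p j := not_le.1 fun h => hsilent ⟨hjobs, hr, h⟩
  have hpos : 0 < α := hα.lt_of_ne fun hα₀ => by
    rw [← hα₀, zero_mul] at hlt
    exact hlt.not_ge (hy.nonneg j t)
  exact priority_of_le hpos hlt.le

theorem priority_le_of_hybridRate_ne_zero (hy : FollowsHybrid I α y) (hα : 0 ≤ α) (hα' : α ≤ 1)
    (hj : hybridRate I α y t j ≠ 0) (hi : IsAvailable I y i t) :
    priority α (I.p j) (y j t) ≤ priority α (I.p i) (y i t) := by
  have hi' := Finset.mem_union.1 ((mem_emitted_union_silent_observe (α := α)).2 hi)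
  rcases State.rate_ne_zero_iff.1 hj with ⟨⟨l, hl, hlsilent⟩, hsel⟩ | ⟨htest, hleast⟩
  · rw [priority_of_mem_emitted hα hsel.1]
    rcases hi' with hi' | hi'
    · exact (hsel.rem_le hi').trans_eq (priority_of_mem_emitted hα hi').symm
    · rw [hy.priority_of_mem_silent hα hi']
      exact (hsel.rem_le hl).trans (hlsilent i hi')
  · obtain ⟨hj', hmin⟩ := State.mem_leastProcessed.1 hleast
    have hc : 0 ≤ (1 - α) / α := div_nonneg (sub_nonneg.2 hα') hα
    rw [hy.priority_of_mem_silent hα hj']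
    rcases hi' with hi' | hi'
    · obtain ⟨l, hl, hlt⟩ : ∃ l ∈ (observe I α y t).silent,
          (1 - α) / α * (observe I α y t).y l < (observe I α y t).rem i := by
        by_contra! hcon
        exact htest ⟨i, hi', hcon⟩
      rw [priority_of_mem_emitted hα hi']
      exact (mul_le_mul_of_nonneg_left (hmin l hl) hc).trans hlt.le
    · rw [hy.priority_of_mem_silent hα hi']
      exact mul_le_mul_of_nonneg_left (hmin i hi') hc

end FollowsHybrid

theorem eq_of_hybridRate_ne_zero (hj : hybridRate I α y t j ≠ 0) (hemitted : α * I.p j ≤ y j t)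
    (hi : hybridRate I α y t i ≠ 0) : i = j := by
  have hsilent : j ∉ (observe I α y t).silent := fun h =>
    have hav := (mem_silent_observe.1 h).1
    (mem_silent_observe.1 h).2 ⟨hav.1, hav.2.1, hemitted⟩
  rcases State.rate_ne_zero_iff.1 hj with ⟨htest, hselj⟩ | ⟨-, hleast⟩
  · rcases State.rate_ne_zero_iff.1 hi with ⟨-, hseli⟩ | ⟨hntest, -⟩
    exacts [hseli.unique hselj, absurd htest hntest]
  · exact absurd (State.mem_leastProcessed.1 hleast).1 hsilent

end Priority

/-! ### The last time of high priorities -/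

/-- The times `τ ≤ t` at which no available job has priority less than `h`. -/
def highTimes (I : Instance) (α : ℝ) (y : ℕ → ℝ → ℝ) (h t : ℝ) : Set ℝ :=
  {τ | τ ≤ t ∧ ∀ j, IsAvailable I y j τ → h ≤ priority α (I.p j) (y j τ)}

/-- The supremum of the times until `t` at which no available job has priority less than `h`.
After it, and until `t`, the machine processes only jobs of priority less than `h`. -/
noncomputable def thresholdTime (I : Instance) (α : ℝ) (y : ℕ → ℝ → ℝ) (h t : ℝ) : ℝ :=
  sSup (highTimes I α y h t)

open Classical in
/-- The jobs released before the threshold time that are processed between the threshold time and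
time `t`. -/
noncomputable def resumedJobs (I : Instance) (α : ℝ) (y : ℕ → ℝ → ℝ) (h t : ℝ) : Finset ℕ :=
  {j ∈ I.jobs | I.r j < thresholdTime I α y h t ∧ y j (thresholdTime I α y h t) < y j t}

section Threshold

variable {I : Instance} {α h t τ : ℝ} {y : ℕ → ℝ → ℝ} {j : ℕ}

theorem highTimes_nonempty (I : Instance) (α : ℝ) (y : ℕ → ℝ → ℝ) (h t : ℝ) :
    (highTimes I α y h t).Nonempty :=
  ⟨min t (-1), min_le_left _ _, fun j hj => by
    linarith [I.r_nonneg j hj.1, hj.2.1, min_le_right t (-1)]⟩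

theorem thresholdTime_le (I : Instance) (α : ℝ) (y : ℕ → ℝ → ℝ) (h t : ℝ) :
    thresholdTime I α y h t ≤ t :=
  csSup_le (highTimes_nonempty I α y h t) fun _ hτ => hτ.1

theorem le_thresholdTime (hτ : τ ∈ highTimes I α y h t) : τ ≤ thresholdTime I α y h t :=
  le_csSup ⟨t, fun _ hτ => hτ.1⟩ hτ

theorem mem_resumedJobs : j ∈ resumedJobs I α y h t ↔ j ∈ I.jobs ∧
    I.r j < thresholdTime I α y h t ∧ y j (thresholdTime I α y h t) < y j t := by
  simp [resumedJobs]

namespace FollowsHybrid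

theorem sub_thresholdTime_le_sum (hy : FollowsHybrid I α y) (h t : ℝ) :
    t - thresholdTime I α y h t ≤
      ∑ j ∈ I.jobs, (y j t - y j (thresholdTime I α y h t)) := by
  refine hy.le_sum_sub (thresholdTime_le I α y h t) fun τ hτ => ?_
  by_contra! hidle
  exact hτ.1.not_ge (le_thresholdTime ⟨hτ.2.le, fun j hj => absurd hj (hidle j)⟩)

theorem le_thresholdTime_of_hybridRate_ne_zero (hy : FollowsHybrid I α y) (hα : 0 ≤ α)
    (hα' : α ≤ 1) (hj : hybridRate I α y τ j ≠ 0) (hτ : τ ≤ t)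
    (hpriority : h ≤ priority α (I.p j) (y j τ)) : τ ≤ thresholdTime I α y h t :=
  le_thresholdTime ⟨hτ, fun _ hi =>
    hpriority.trans (hy.priority_le_of_hybridRate_ne_zero hα hα' hj hi)⟩

theorem priority_le_of_mem_Icc (hy : FollowsHybrid I α y) (hα : 0 ≤ α) (hα' : α ≤ 1) {v : ℝ}
    (hlt : y j (thresholdTime I α y h t) < y j t)
    (hv : v ∈ Icc (y j (thresholdTime I α y h t)) (y j t)) : priority α (I.p j) v ≤ h := by
  have hinner : Ioo (y j (thresholdTime I α y h t)) (y j t) ⊆ {v | priority α (I.p j) v ≤ h} := by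
    intro v hv
    obtain ⟨τ, hτ, rfl, hrate⟩ := hy.exists_hybridRate_ne_zero hv.1.le hv.2
    by_contra hhigh
    have := hy.le_thresholdTime_of_hybridRate_ne_zero hα hα' hrate hτ.2.le (not_le.1 hhigh).le
    exact hv.1.ne (by rw [this.antisymm hτ.1])
  have hclosed : IsClosed {v | priority α (I.p j) v ≤ h} :=
    isClosed_le (continuous_priority α (I.p j)) continuous_const
  rw [← closure_Ioo hlt.ne] at hv
  exact closure_minimal hinner hclosed hv

theorem le_priority_thresholdTime (hy : FollowsHybrid I α y) (hj : j ∈ I.jobs)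
    (hr : I.r j < thresholdTime I α y h t) (hp : y j (thresholdTime I α y h t) < I.p j) :
    h ≤ priority α (I.p j) (y j (thresholdTime I α y h t)) := by
  have hclosure : thresholdTime I α y h t ∈ closure (Ioi (I.r j) ∩ highTimes I α y h t) :=
    isOpen_Ioi.inter_closure ⟨hr, csSup_mem_closure (highTimes_nonempty I α y h t)
      ⟨t, fun _ hτ => hτ.1⟩⟩
  have hcont : Continuous fun τ => priority α (I.p j) (y j τ) :=
    (continuous_priority α (I.p j)).comp (hy.continuous j)
  exact continuousWithinAt_const.closure_le hclosure hcont.continuousWithinAt fun τ hτ =>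
    hτ.2.2 j ⟨hj, hτ.1.le, (hy.monotone j (le_thresholdTime hτ.2)).trans_lt hp⟩

theorem mul_le_of_thresholdTime_le (hy : FollowsHybrid I α y) (hα : 0 ≤ α) (hα' : α ≤ 1)
    (hh : 0 ≤ h) (hj : j ∈ I.jobs) (hr : thresholdTime I α y h t ≤ I.r j) :
    (1 - α) * y j t ≤ h := by
  have hstart : y j (thresholdTime I α y h t) = 0 := hy.eq_zero_of_le_release hr
  rcases (hy.nonneg j t).eq_or_lt with hzero | hpos
  · rwa [← hzero, mul_zero]
  · refine (mul_le_priority_mul hα (hy.le_p hj t)).trans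
      (hy.priority_le_of_mem_Icc hα hα' (t := t) (by rwa [hstart]) ?_)
    rw [hstart]
    exact ⟨mul_nonneg hα hpos.le, mul_le_of_le_one_left hpos.le hα'⟩

theorem priority_eq_of_mem_resumedJobs (hy : FollowsHybrid I α y) (hα : 0 ≤ α) (hα' : α ≤ 1)
    (hj : j ∈ resumedJobs I α y h t) :
    priority α (I.p j) (y j (thresholdTime I α y h t)) = h := by
  obtain ⟨hjobs, hr, hlt⟩ := mem_resumedJobs.1 hj
  exact (hy.priority_le_of_mem_Icc hα hα' hlt ⟨le_rfl, hlt.le⟩).antisymm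
    (hy.le_priority_thresholdTime hjobs hr (hlt.trans_le (hy.le_p hjobs t)))

/-- Otherwise the priority of the job would grow while it is processed. -/
theorem mul_p_le_of_mem_resumedJobs (hy : FollowsHybrid I α y) (hα : 0 ≤ α) (hα' : α < 1)
    (hj : j ∈ resumedJobs I α y h t) : α * I.p j ≤ y j (thresholdTime I α y h t) := by
  obtain ⟨-, -, hlt⟩ := mem_resumedJobs.1 hj
  by_contra! hsilent
  have hpos : 0 < α := hα.lt_of_ne fun hα₀ => by
    rw [← hα₀, zero_mul] at hsilent
    exact hsilent.not_ge (hy.nonneg j _)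
  obtain ⟨v, hv, hv'⟩ := exists_between (lt_min hlt hsilent)
  have hle : priority α (I.p j) v ≤ priority α (I.p j) (y j (thresholdTime I α y h t)) := by
    rw [hy.priority_eq_of_mem_resumedJobs hα hα'.le hj]
    exact hy.priority_le_of_mem_Icc hα hα'.le hlt ⟨hv.le, (hv'.trans_le (min_le_left _ _)).le⟩
  rw [priority_of_le hpos (hv'.trans_le (min_le_right _ _)).le, priority_of_le hpos hsilent.le,
    mul_le_mul_iff_right₀ (div_pos (sub_pos.2 hα') hpos)] at hle
  exact hle.not_gt hv

theorem p_sub_eq_of_mem_resumedJobs (hy : FollowsHybrid I α y) (hα : 0 ≤ α) (hα' : α < 1)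
    (hj : j ∈ resumedJobs I α y h t) : I.p j - y j (thresholdTime I α y h t) = h := by
  rw [← priority_of_ge hα (hy.mul_p_le_of_mem_resumedJobs hα hα' hj)]
  exact hy.priority_eq_of_mem_resumedJobs hα hα'.le hj

theorem hybridRate_ne_zero_of_mem_resumedJobs (hy : FollowsHybrid I α y) (hα : 0 ≤ α) (hα' : α ≤ 1)
    (hj : j ∈ resumedJobs I α y h t) : hybridRate I α y (thresholdTime I α y h t) j ≠ 0 := by
  obtain ⟨-, -, hlt⟩ := mem_resumedJobs.1 hj
  obtain ⟨τ, hτ, hyτ, hrate⟩ := hy.exists_hybridRate_ne_zero le_rfl hlt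
  have hpriority : priority α (I.p j) (y j τ) = h := by
    rw [hyτ, hy.priority_eq_of_mem_resumedJobs hα hα' hj]
  rwa [hτ.1.antisymm
    (hy.le_thresholdTime_of_hybridRate_ne_zero hα hα' hrate hτ.2.le hpriority.ge)]

theorem card_resumedJobs_le_one (hy : FollowsHybrid I α y) (hα : 0 ≤ α) (hα' : α < 1) :
    (resumedJobs I α y h t).card ≤ 1 :=
  Finset.card_le_one.2 fun _ hi _ hj => eq_of_hybridRate_ne_zero
    (hy.hybridRate_ne_zero_of_mem_resumedJobs hα hα'.le hj)
    (hy.mul_p_le_of_mem_resumedJobs hα hα' hj)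
    (hy.hybridRate_ne_zero_of_mem_resumedJobs hα hα'.le hi)

theorem le_p_sub_of_notMem_resumedJobs (hy : FollowsHybrid I α y) (hj : IsAvailable I y j t)
    (hr : I.r j < thresholdTime I α y h t) (hnot : j ∉ resumedJobs I α y h t) :
    h ≤ I.p j - y j t := by
  have hstay : y j (thresholdTime I α y h t) = y j t :=
    (hy.monotone j (thresholdTime_le I α y h t)).antisymm
      (not_lt.1 fun hlt => hnot (mem_resumedJobs.2 ⟨hj.1, hr, hlt⟩))
  rw [← hstay]
  exact (hy.le_priority_thresholdTime hj.1 hr (hstay ▸ hj.2.2)).trans (priority_le_sub ..)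

end FollowsHybrid

end Threshold

/-! ### Local competitiveness -/

section Counting

variable {ι κ M : Type*} [AddCommGroup M] [LinearOrder M] [IsOrderedAddMonoid M] {a : ι → M}

theorem card_le_one_of_sum_le {J : Finset ι} (hpos : ∀ j ∈ J, 0 < a j)
    (hJ : ∀ j ∈ J, ∑ i ∈ J with a i ≤ a j, a i ≤ a j) : J.card ≤ 1 := by
  classical
  have hnot_le : ∀ i ∈ J, ∀ j ∈ J, i ≠ j → ¬ a i ≤ a j := by
    intro i hi j hj hij hle
    have hpair : ∑ l ∈ {i, j}, a l ≤ ∑ l ∈ J with a l ≤ a j, a l :=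
      Finset.sum_le_sum_of_subset_of_nonneg (by grind)
        fun l hl _ => (hpos l (Finset.mem_filter.1 hl).1).le
    rw [Finset.sum_pair hij] at hpair
    exact (lt_add_of_pos_left (a j) (hpos i hi)).not_ge (hpair.trans (hJ j hj))
  refine Finset.card_le_one.2 fun i hi j hj => ?_
  by_contra hij
  exact (le_total (a i) (a j)).elim (hnot_le i hi j hj hij) (hnot_le j hj i hi (Ne.symm hij))

theorem card_le_card_add_one_of_sum_le (b : κ → M) (R : Finset κ) {J : Finset ι}
    (hpos : ∀ j ∈ J, 0 < a j)
    (hJ : ∀ j ∈ J, ∑ i ∈ J with a i ≤ a j, a i ≤ ∑ i ∈ R with b i ≤ a j, b i + a j) :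
    J.card ≤ R.card + 1 := by
  classical
  induction R using Finset.induction_on generalizing J with
  | empty => exact card_le_one_of_sum_le hpos (by simpa using hJ)
  | insert m R hm ih =>
    rw [Finset.card_insert_of_notMem hm]
    by_cases hex : (J.filter fun j => b m ≤ a j).Nonempty
    -- Remove `m` together with the least `a k` above `b m`.
    · obtain ⟨k, hk, hkmin⟩ := Finset.exists_min_image _ a hex
      obtain ⟨hkJ, hbk⟩ := Finset.mem_filter.1 hk
      suffices (J.erase k).card ≤ R.card + 1 by
        rw [← Finset.card_erase_add_one hkJ]
        exact Nat.succ_le_succ this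
      refine ih (fun j hj => hpos j (Finset.mem_of_mem_erase hj)) fun j hj => ?_
      have hj' := Finset.mem_of_mem_erase hj
      have hsum := hJ j hj'
      rw [Finset.filter_insert] at hsum
      rw [Finset.filter_erase]
      by_cases hbj : b m ≤ a j
      · have hkj : k ∈ J.filter fun i => a i ≤ a j :=
          Finset.mem_filter.2 ⟨hkJ, hkmin j (Finset.mem_filter.2 ⟨hj', hbj⟩)⟩
        rw [if_pos hbj, Finset.sum_insert (by simp [hm]), ← Finset.add_sum_erase _ a hkj,
          add_assoc] at hsum
        exact le_of_add_le_add_left (hsum.trans (add_le_add_left hbk _))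
      · rw [if_neg hbj] at hsum
        have hkj : k ∉ J.filter fun i => a i ≤ a j := fun hkj =>
          hbj (hbk.trans (Finset.mem_filter.1 hkj).2)
        rwa [Finset.erase_eq_of_notMem hkj]
    · refine (ih hpos fun j hj => ?_).trans (Nat.le_succ _)
      have hsum := hJ j hj
      rwa [Finset.filter_insert, if_neg fun hle => hex ⟨j, Finset.mem_filter.2 ⟨hj, hle⟩⟩] at hsum

end Counting

theorem eventually_filter_le_eq {ι X : Type*} [LinearOrder X] [TopologicalSpace X]
    [OrderTopology X] (R : Finset ι) (f : ι → X) (u : X) :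
    ∀ᶠ h in 𝓝[≥] u, R.filter (f · ≤ h) = R.filter (f · ≤ u) :=
  ((eventually_all_finset R).2 fun i _ => eventually_nhdsGE_le_iff (f i) u).mono
    fun _ h => Finset.filter_congr h

open Classical in
/-- The jobs released between times `s` and `t`, both included. -/
noncomputable def arrivals (I : Instance) (s t : ℝ) : Finset ℕ :=
  {j ∈ I.jobs | s ≤ I.r j ∧ I.r j ≤ t}

section Local

variable {I : Instance} {α h s t u : ℝ} {y : ℕ → ℝ → ℝ} {j : ℕ}

theorem mem_arrivals : j ∈ arrivals I s t ↔ j ∈ I.jobs ∧ s ≤ I.r j ∧ I.r j ≤ t := by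
  simp [arrivals]

theorem Schedule.sum_p_arrivals_le (S : Schedule I) (hst : s ≤ t) :
    ∑ j ∈ arrivals I s t \ S.available t, I.p j ≤ t - s := by
  have hsub : arrivals I s t \ S.available t ⊆ I.jobs := fun j hj =>
    (mem_arrivals.1 (Finset.mem_sdiff.1 hj).1).1
  calc ∑ j ∈ arrivals I s t \ S.available t, I.p j
      ≤ ∑ j ∈ arrivals I s t \ S.available t, (S.y j t - S.y j s) :=
        Finset.sum_le_sum fun j hj => ?_
    _ ≤ ∑ j ∈ I.jobs, (S.y j t - S.y j s) :=
        Finset.sum_le_sum_of_subset_of_nonneg hsub fun j hj _ => sub_nonneg.2 (S.mono j hj hst)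
    _ ≤ t - s := S.capacity s t hst
  obtain ⟨harrival, hnot⟩ := Finset.mem_sdiff.1 hj
  obtain ⟨hjobs, hsr, hrt⟩ := mem_arrivals.1 harrival
  rw [S.eq_zero j hjobs s hsr, sub_zero]
  by_contra! hlt
  exact hnot (S.mem_available.2 ⟨hjobs, hrt, hlt⟩)

theorem disjoint_arrivals_resumedJobs :
    Disjoint (arrivals I (thresholdTime I α y h t) t) (resumedJobs I α y h t) :=
  Finset.disjoint_left.2 fun _ harrival hresumed =>
    (mem_arrivals.1 harrival).2.1.not_gt (mem_resumedJobs.1 hresumed).2.1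

namespace FollowsHybrid

theorem sum_sub_thresholdTime_eq (hy : FollowsHybrid I α y) (hα : 0 ≤ α) (hα' : α < 1) :
    ∑ j ∈ I.jobs, (y j t - y j (thresholdTime I α y h t)) =
      ∑ j ∈ arrivals I (thresholdTime I α y h t) t, y j t +
        ∑ j ∈ resumedJobs I α y h t, (h - (I.p j - y j t)) := by
  set s := thresholdTime I α y h t
  have hsub : arrivals I s t ∪ resumedJobs I α y h t ⊆ I.jobs :=
    Finset.union_subset (fun j hj => (mem_arrivals.1 hj).1) fun j hj => (mem_resumedJobs.1 hj).1
  rw [← Finset.sum_subset hsub, Finset.sum_union disjoint_arrivals_resumedJobs]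
  · congr 1 <;> refine Finset.sum_congr rfl fun j hj => ?_
    · rw [hy.eq_zero_of_le_release (mem_arrivals.1 hj).2.1, sub_zero]
    · rw [← hy.p_sub_eq_of_mem_resumedJobs hα hα' hj]
      ring
  · intro j hj hnot
    rw [Finset.mem_union, mem_arrivals, mem_resumedJobs] at hnot
    refine sub_eq_zero.2 (le_antisymm ?_ (hy.monotone j (thresholdTime_le I α y h t)))
    by_contra! hlt
    have hrt : I.r j ≤ t := by
      by_contra! htr
      exact (hy.nonneg j s).not_gt (hlt.trans_eq (hy.eq_zero_of_le_release htr.le))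
    exact hnot ((le_or_gt s (I.r j)).imp (fun h => ⟨hj, h, hrt⟩) fun h => ⟨hj, h, hlt⟩)

theorem resumedJobs_eq_empty (hy : FollowsHybrid I α y) (hα : 0 ≤ α) (hα' : α < 1)
    (hh : ∀ j ∈ I.jobs, I.p j < h) : resumedJobs I α y h t = ∅ :=
  Finset.eq_empty_of_forall_notMem fun j hj => by
    linarith [hh j (mem_resumedJobs.1 hj).1, hy.p_sub_eq_of_mem_resumedJobs hα hα' hj,
      hy.nonneg j (thresholdTime I α y h t)]

variable {S S' : Schedule I}

theorem sum_rem_le_arrivals (hS : FollowsHybrid I α S.y) :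
    ∑ j ∈ S.available t \ S'.available t with S.rem j t < h, S.rem j t ≤
      ∑ j ∈ arrivals I (thresholdTime I α S.y h t) t \ S'.available t, S.rem j t +
        ∑ j ∈ resumedJobs I α S.y h t, S.rem j t := by
  have hrem : ∀ {j}, j ∈ I.jobs → 0 ≤ S.rem j t := fun hj => sub_nonneg.2 (S.le_p _ hj t)
  rw [← Finset.sum_union (disjoint_arrivals_resumedJobs.mono_left Finset.sdiff_subset)]
  refine Finset.sum_le_sum_of_subset_of_nonneg (fun j hj => ?_) fun j hj _ => ?_
  · rw [Finset.mem_filter, Finset.mem_sdiff, S.mem_available] at hj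
    obtain ⟨⟨hav, hnot⟩, hlt⟩ := hj
    rw [Finset.mem_union, Finset.mem_sdiff, mem_arrivals]
    by_contra! hcon
    have hr : I.r j < thresholdTime I α S.y h t :=
      not_le.1 fun hr => hnot (hcon.1 ⟨hav.1, hr, hav.2.1⟩)
    exact hlt.not_ge (hS.le_p_sub_of_notMem_resumedJobs hav hr hcon.2)
  · rcases Finset.mem_union.1 hj with hj | hj
    · exact hrem (mem_arrivals.1 (Finset.mem_sdiff.1 hj).1).1
    · exact hrem (mem_resumedJobs.1 hj).1

/-- Since the threshold time, the hybrid rule has worked without interruption on the arrivals and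
on the resumed jobs only, while the other schedule has completed the arrivals not in
`S'.available t`. -/
theorem sum_rem_le (hS : FollowsHybrid I α S.y) (hα : 0 ≤ α) (hα' : α < 1) (hh : 0 ≤ h) :
    ∑ j ∈ S.available t \ S'.available t with S.rem j t < h, S.rem j t ≤
      ∑ i ∈ S'.available t with (1 - α) * S.y i t ≤ h, S.y i t +
        (resumedJobs I α S.y h t).card * h := by
  have hleft := hS.sum_rem_le_arrivals (S' := S') (h := h) (t := t)
  have hbusy := hS.sub_thresholdTime_le_sum h t
  have hother := S'.sum_p_arrivals_le (thresholdTime_le I α S.y h t)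
  rw [hS.sum_sub_thresholdTime_eq hα hα', Finset.sum_sub_distrib, Finset.sum_const, nsmul_eq_mul,
    ← Finset.sum_inter_add_sum_sdiff _ (S'.available t)] at hbusy
  set A := arrivals I (thresholdTime I α S.y h t) t
  have hsplit : ∑ j ∈ A \ S'.available t, S.rem j t =
      ∑ j ∈ A \ S'.available t, I.p j - ∑ j ∈ A \ S'.available t, S.y j t :=
    Finset.sum_sub_distrib ..
  have hright : ∑ j ∈ A ∩ S'.available t, S.y j t ≤
      ∑ i ∈ S'.available t with (1 - α) * S.y i t ≤ h, S.y i t := by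
    refine Finset.sum_le_sum_of_subset_of_nonneg (fun j hj => ?_) fun j _ _ => hS.nonneg j t
    obtain ⟨harrival, hav⟩ := Finset.mem_inter.1 hj
    obtain ⟨hjobs, hr, -⟩ := mem_arrivals.1 harrival
    exact Finset.mem_filter.2 ⟨hav, hS.mul_le_of_thresholdTime_le hα hα'.le hh hjobs hr⟩
  simp only [Schedule.rem] at *
  linarith

theorem available_eq_empty (hS : FollowsHybrid I α S.y) (hα : 0 ≤ α) (hα' : α < 1)
    (hempty : S'.available t = ∅) : S.available t = ∅ := by
  set P := ∑ j ∈ I.jobs, I.p j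
  have hp : ∀ j ∈ I.jobs, I.p j < P + 1 := fun j hj =>
    (Finset.single_le_sum (fun i hi => (I.p_pos i hi).le) hj).trans_lt (lt_add_one P)
  have hP : 0 ≤ P + 1 := by
    linarith [Finset.sum_nonneg fun j hj => (I.p_pos j hj).le]
  have hsum := hS.sum_rem_le (S' := S') (t := t) hα hα' hP
  rw [hS.resumedJobs_eq_empty hα hα' hp, hempty, Finset.sdiff_empty, Finset.filter_empty,
    Finset.sum_empty, Finset.card_empty, Nat.cast_zero, zero_mul, add_zero] at hsum
  refine Finset.eq_empty_of_forall_notMem fun j hj => hsum.not_gt ?_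
  have hav := S.mem_available.1 hj
  have hlt : S.rem j t < P + 1 := (sub_le_self _ (S.nonneg hav.1 t)).trans_lt (hp j hav.1)
  exact Finset.sum_pos (fun i hi => sub_pos.2 (S.mem_available.1 (Finset.mem_filter.1 hi).1).2.2)
    ⟨j, Finset.mem_filter.2 ⟨hj, hlt⟩⟩

/-- The limit of `sum_rem_le` as `h` decreases to `u`. -/
theorem sum_rem_le_add (hS : FollowsHybrid I α S.y) (hα : 0 ≤ α) (hα' : α < 1) (hu : 0 ≤ u) :
    ∑ j ∈ S.available t \ S'.available t with S.rem j t ≤ u, S.rem j t ≤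
      ∑ i ∈ S'.available t with (1 - α) * S.y i t ≤ u, S.y i t + u := by
  have hlim : Tendsto (fun h => ∑ i ∈ S'.available t with (1 - α) * S.y i t ≤ u, S.y i t + h)
      (𝓝[>] u) (𝓝 (∑ i ∈ S'.available t with (1 - α) * S.y i t ≤ u, S.y i t + u)) :=
    ((continuous_const.add continuous_id).tendsto u).mono_left nhdsWithin_le_nhds
  refine ge_of_tendsto hlim ?_
  filter_upwards [nhdsWithin_mono u Ioi_subset_Ici_self
      (eventually_filter_le_eq (S'.available t) (fun i => (1 - α) * S.y i t) u),
    self_mem_nhdsWithin] with h hfilter hlt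
  rw [mem_Ioi] at hlt
  have hh : 0 ≤ h := hu.trans hlt.le
  have hcard : ((resumedJobs I α S.y h t).card : ℝ) ≤ 1 :=
    mod_cast hS.card_resumedJobs_le_one hα hα'
  calc ∑ j ∈ S.available t \ S'.available t with S.rem j t ≤ u, S.rem j t
      ≤ ∑ j ∈ S.available t \ S'.available t with S.rem j t < h, S.rem j t :=
        Finset.sum_le_sum_of_subset_of_nonneg
          (Finset.monotone_filter_right _ fun _ _ hle => hle.trans_lt hlt) fun j hj _ => ?_
    _ ≤ ∑ i ∈ S'.available t with (1 - α) * S.y i t ≤ h, S.y i t +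
          (resumedJobs I α S.y h t).card * h := hS.sum_rem_le hα hα' hh
    _ ≤ ∑ i ∈ S'.available t with (1 - α) * S.y i t ≤ u, S.y i t + h := by
        rw [hfilter]
        exact add_le_add_right (mul_le_of_le_one_left hh hcard) _
  rw [Finset.mem_filter, Finset.mem_sdiff, S.mem_available] at hj
  exact (sub_pos.2 hj.1.1.2.2).le

theorem card_available_sdiff_le (hS : FollowsHybrid I α S.y) (hα : 0 ≤ α) (hα' : α < 1) {c : ℕ}
    (hc : 1 ≤ c * (1 - α)) :
    (S.available t \ S'.available t).card ≤ (S'.available t).card * c + 1 := by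
  have hpos : ∀ j ∈ S.available t \ S'.available t, 0 < S.rem j t := fun j hj =>
    sub_pos.2 (S.mem_available.1 (Finset.mem_sdiff.1 hj).1).2.2
  -- Replacing each job of `S'` by `c` copies makes up for the factor `1 - α`.
  have hcopies : ∀ u, ∑ i ∈ S'.available t with (1 - α) * S.y i t ≤ u, S.y i t ≤
      ∑ i ∈ S'.available t ×ˢ Finset.range c with (1 - α) * S.y i.1 t ≤ u,
        (1 - α) * S.y i.1 t := fun u => by
    rw [Finset.filter_product_left fun i => (1 - α) * S.y i t ≤ u, Finset.sum_product]
    refine Finset.sum_le_sum fun i _ => ?_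
    calc S.y i t ≤ c * (1 - α) * S.y i t := le_mul_of_one_le_left (hS.nonneg i t) hc
      _ = ∑ _k ∈ Finset.range c, (1 - α) * S.y i t := by
        rw [Finset.sum_const, Finset.card_range, nsmul_eq_mul, mul_assoc]
  have := card_le_card_add_one_of_sum_le (fun i : ℕ × ℕ => (1 - α) * S.y i.1 t)
    (S'.available t ×ˢ Finset.range c) hpos fun j hj =>
      (hS.sum_rem_le_add hα hα' (hpos j hj).le).trans (add_le_add_left (hcopies _) _)
  rwa [Finset.card_product, Finset.card_range] at this

theorem card_available_le (hS : FollowsHybrid I α S.y) (hα : 0 ≤ α) (hα' : α < 1)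
    (S' : Schedule I) (t : ℝ) :
    ((S.available t).card : ℝ) ≤ 4 / (1 - α) * (S'.available t).card := by
  rcases (S'.available t).eq_empty_or_nonempty with hempty | hne
  · rw [hS.available_eq_empty hα hα' hempty, hempty]
    simp
  have hβ : 0 < 1 - α := sub_pos.2 hα'
  set c := ⌈1 / (1 - α)⌉₊
  have hc : 1 ≤ c * (1 - α) := (div_le_iff₀ hβ).1 (Nat.le_ceil _)
  have hc' : (c : ℝ) + 2 ≤ 4 / (1 - α) := by
    have hceil : (c : ℝ) < 1 / (1 - α) + 1 := Nat.ceil_lt_add_one (by positivity)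
    have hone : 1 ≤ 1 / (1 - α) := (one_le_div hβ).2 (sub_le_self 1 hα)
    have hfour : 4 / (1 - α) = 4 * (1 / (1 - α)) := by ring
    linarith
  have hcard : (S.available t).card ≤ (c + 2) * (S'.available t).card := by
    have hsdiff := hS.card_available_sdiff_le (S' := S') (t := t) hα hα' hc
    have hsplit := Finset.card_le_card_sdiff_add_card (s := S.available t) (t := S'.available t)
    have hone : 1 ≤ (S'.available t).card := hne.card_pos
    linarith
  calc ((S.available t).card : ℝ) ≤ ((c + 2) * (S'.available t).card : ℕ) := mod_cast hcard
    _ = ((c : ℝ) + 2) * (S'.available t).card := by push_cast; ring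
    _ ≤ 4 / (1 - α) * (S'.available t).card := by gcongr

end FollowsHybrid

end Local

/-! ### Total flow time -/

namespace Schedule

open MeasureTheory

variable {I : Instance} (S : Schedule I)

theorem card_available_eq_sum (t : ℝ) : ((S.available t).card : ℝ) =
    ∑ j ∈ I.jobs, (Ico (I.r j) (S.completion j)).indicator (fun _ => (1 : ℝ)) t := by
  classical
  rw [available, Finset.card_filter, Nat.cast_sum]
  refine Finset.sum_congr rfl fun j _ => ?_
  simp [indicator_apply]

theorem integrable_indicator_Ico (j : ℕ) :
    Integrable ((Ico (I.r j) (S.completion j)).indicator (fun _ => (1 : ℝ))) := by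
  rw [integrable_indicator_iff measurableSet_Ico]
  exact integrableOn_const (by simp)

theorem integrable_card_available : Integrable fun t => ((S.available t).card : ℝ) := by
  simp only [card_available_eq_sum]
  exact integrable_finsetSum _ fun j _ => S.integrable_indicator_Ico j

theorem flowTime_eq_integral : S.flowTime = ∫ t, ((S.available t).card : ℝ) := by
  simp only [card_available_eq_sum]
  rw [integral_finsetSum _ fun j _ => S.integrable_indicator_Ico j]
  refine Finset.sum_congr rfl fun j hj => ?_
  rw [integral_indicator measurableSet_Ico]
  simp [(S.completion_mem hj).1]

end Schedule

theorem hybrid_isCompetitive {α : ℝ} (hα : 0 ≤ α) (hα' : α < 1) :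
    (hybrid α).IsCompetitive (4 / (1 - α)) := by
  intro I S
  rw [Schedule.flowTime_eq_integral, Schedule.flowTime_eq_integral,
    ← MeasureTheory.integral_const_mul]
  exact MeasureTheory.integral_mono (Schedule.integrable_card_available _)
    (S.integrable_card_available.const_mul _)
    fun t => (followsHybrid_hybrid α I).card_available_le hα hα' S t

end FlowTime

theorem theorem1 :
    ∃ K : ℝ, 0 < K ∧ ∀ α : ℝ, 0 ≤ α → α < 1 →
      ∃ A : FlowTime.Algorithm,
        A.IsClairvoyantOnline α ∧
        (∀ I : FlowTime.Instance, (A I).IsHybrid α) ∧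
        A.IsCompetitive (K / (1 - α)) :=
  ⟨4, four_pos, fun α hα hα' => ⟨FlowTime.hybrid α, FlowTime.hybrid_isClairvoyantOnline hα',
    fun I => (FlowTime.followsHybrid_hybrid α I).isHybrid,
    FlowTime.hybrid_isCompetitive hα hα'⟩⟩
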